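/- Let $r\ge 1$, let $K$ be a field, and let $(R_{\alpha,n})_{0\le\alpha\le r+1,\,n\in\mathbb Z}$ in $K$ satisfy the $A_r$ $Q$-system $R_{\alpha,n+1}R_{\alpha,n-1}=R_{\alpha,n}^2+R_{\alpha+1,n}R_{\alpha-1,n}$ ($1\le\alpha\le r$), $R_{0,n}=R_{r+1,n}=1$, with all $R_{\alpha,n}\neq 0$. Let ${\mathbf m}=(m_1,\dots,m_r)\in\mathbb Z^r$ be a Motzkin path ($|m_\alpha-m_{\alpha+1}|\le 1$) with $\min_\alpha m_\alpha=0$. *Weights.* With $\lambda_{\alpha,n}=R_{\alpha,n+1}/R_{\alpha,n}$ and $\mu_{\alpha,n}=R_{\alpha,n}/R_{\alpha-1,n}$ put $y_{2\alpha-1}=\lambda_{\alpha,m_\alpha}/\lambda_{\alpha-1,m_{\alpha-1}}$ for $1\le\alpha\le r+1$, and, for $1\le\alpha\le r$, $$y_{2\alpha}=\frac{\mu_{\alpha+1,m_\alpha+1}}{\mu_{\alpha,m_\alpha}}\,u_\alpha v_\alpha,$$ where $u_\alpha=\lambda_{\alpha+1,m_{\alpha+1}}/\lambda_{\alpha+1,m_\alpha}$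 if $m_\alpha=m_{\alpha+1}+1$ and $u_\alpha=1$ otherwise, and $v_\alpha=\lambda_{\alpha-1,m_\alpha}/\lambda_{\alpha-1,m_{\alpha-1}}$ if $m_{\alpha-1}=m_\alpha+1$ and $v_\alpha=1$ otherwise. (Since $R_0=R_{r+1}=1$, the values $m_0,m_{r+1}$ are immaterial.) *Transfer matrix.* An ascending (descending) segment of ${\mathbf m}$ is a maximal interval $[c,d]\subseteq[1,r]$, $c<d$, on which all steps $m_{k+1}-m_k$ equal $+1$ ($-1$). The compactified graph $\Gamma'_{\mathbf m}$ has vertices $1,\dots,r+1$ and the following weighted oriented edges, $t$ being a formal variable: loops $i\to i$ of weight $ty_{2i-1}$; edges $i\to i+1$ of weight $1$; edges $i+1\to i$ of weight $ty_{2i}$; for each descending segment $[c,d]$ the edges $a\to b$ with $c\le b$, $b+2\le a\le d+1$, of weight $t\prod_{b\le j<a}y_{2j}\big/\prod_{b<j<a}y_{2j-1}$; for each ascending segment $[c,d]$ the edges $a\to b$ with $c\le a$, $a+2\le b\le d+1$, of weight $(-1)^{b-a-1}$. The compact transfer matrix $T'_{\mathbf m}$ is the $(r+1)\times(r+1)$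 matrix whose $(b,a)$ entry is the weight of $a\to b$ (zero if there is no such edge). Let $N_{\mathbf m}$ be its strictly lower triangular part and $B_{\mathbf m}$ its upper triangular part (including the diagonal), so $T'_{\mathbf m}=N_{\mathbf m}+B_{\mathbf m}$. *Elementary matrices.* Let $\sigma_{\mathbf m}=(i_1,\dots,i_r)$ (resp. $\tau_{\mathbf m}=(j_1,\dots,j_r)$) be obtained from $(r,r-1,\dots,1)$ by reversing the block $d,d-1,\dots,c$ for every ascending (resp. descending) segment $[c,d]$. Put $f_i=I+E_{i+1,i}$, $e_i=I+\frac{y_{2i}}{y_{2i-1}}E_{i,i+1}$, $d_i=I+(y_{2i-1}-1)E_{i,i}$, and $F=f_{i_1}\cdots f_{i_r}$, $D=d_1\cdots d_{r+1}$, $E=e_{j_1}\cdots e_{j_r}$, $P_{\mathbf m}=FDE$. Then: 1. $F$ is invertible, $N_{\mathbf m}=I-(f_{i_1}\cdots f_{i_r})^{-1}$ and $B_{\mathbf m}=t\,d_1\cdots d_{r+1}\,e_{j_1}\cdots e_{j_r}$. 2. $I-T'_{\mathbf m}$ and $I-tP_{\mathbf m}$ are invertible over $K[[t]]$, and $(I-T'_{\mathbf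 m})^{-1}=(I-tP_{\mathbf m})^{-1}f_{i_1}\cdots f_{i_r}$. 3. $P_{\mathbf m}$ lies in the double Bruhat cell $B_+uB_+\cap B_-vB_-$ of $GL_{r+1}(K)$, where $u=s_{i_1}\cdots s_{i_r}$ and $v=s_{j_1}\cdots s_{j_r}$, with $s_i=(i\ \,i+1)$, are Coxeter elements of the symmetric group $S_{r+1}$ (products of all simple reflections, each taken once). 4. For all $n\ge0$, $R_{1,n+m_1+1}=R_{1,m_1+1}\,[t^n]\big((I-T'_{\mathbf m})^{-1}\big)_{1,1}$, and $$\big((I-T'_{\mathbf m})^{-1}\big)_{1,1}=\begin{cases}\displaystyle\sum_{a=1}^{a_1+1}\big((I-tP_{\mathbf m})^{-1}\big)_{1,a}&\text{if ${\mathbf m}$ has an ascending segment,}\\[2mm]\displaystyle\sum_{a=1}^{r+1}\big((I-tP_{\mathbf m})^{-1}\big)_{1,a}&\text{otherwise,}\end{cases}$$ where $a_1$ is the starting position of the first ascending segment. -/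

import Mathlib

open scoped PowerSeries

/-! Conventions.  Everything is labelled from `1` as usual in the subject: Motzkin paths are
`m 1, …, m r`, the vertices of the compactified graph are `1, …, r+1`.  A row or column
`p : Fin (r + 1)` of an `(r+1) × (r+1)` matrix carries the label `p + 1`. -/

namespace QSystem

/-- `m 1, …, m r` is a Motzkin path in the fundamental domain: consecutive heights differ by at
most one and the minimal height is `0`. Values of `m` outside `{1, …, r}` are irrelevant. -/
structure IsMotzkinPath (r : ℕ) (m : ℕ → ℤ) : Prop where
  step : ∀ α, 1 ≤ α → α < r → |m α - m (α + 1)| ≤ 1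
  nonneg : ∀ α, 1 ≤ α → α ≤ r → 0 ≤ m α
  exists_zero : ∃ α, 1 ≤ α ∧ α ≤ r ∧ m α = 0

/-- `R α n` (`0 ≤ α ≤ r + 1`, `n ∈ ℤ`) solves the `A_r` `Q`-system, and none of its members
vanishes (as is the case for cluster variables). -/
structure IsSolution {K : Type*} [Field K] (r : ℕ) (R : ℕ → ℤ → K) : Prop where
  bot : ∀ n, R 0 n = 1
  top : ∀ n, R (r + 1) n = 1
  rec_eq : ∀ α, 1 ≤ α → α ≤ r → ∀ n,
    R α (n + 1) * R α (n - 1) = R α n ^ 2 + R (α + 1) n * R (α - 1) n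
  ne_zero : ∀ α, 1 ≤ α → α ≤ r → ∀ n, R α n ≠ 0

/-! ### Ascending and descending segments -/

/-- `[a, b]` (with `a < b`) is a maximal segment of `m` on which every step equals `ε`.
It is an ascending segment for `ε = 1` and a descending segment for `ε = -1`. -/
def IsSegment (r : ℕ) (m : ℕ → ℤ) (ε : ℤ) (a b : ℕ) : Prop :=
  1 ≤ a ∧ a < b ∧ b ≤ r ∧ (∀ k < b, a ≤ k → m (k + 1) = m k + ε) ∧
    (a = 1 ∨ m a ≠ m (a - 1) + ε) ∧ (b = r ∨ m (b + 1) ≠ m b + ε)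

instance (r : ℕ) (m : ℕ → ℤ) (ε : ℤ) (a b : ℕ) : Decidable (IsSegment r m ε a b) := by
  unfold IsSegment; infer_instance

/-- The list of all maximal segments with step `ε`, from left to right. -/
def segments (r : ℕ) (m : ℕ → ℤ) (ε : ℤ) : List (ℕ × ℕ) :=
  ((List.range' 1 r) ×ˢ (List.range' 1 r)).filter fun p => IsSegment r m ε p.1 p.2

/-- The permutation `ω[a, b] = (a, b)(a + 1, b - 1) ⋯`. -/
def omega (a b : ℕ) : Equiv.Perm ℕ :=
  Function.Involutive.toPerm (fun i => if a ≤ i ∧ i ≤ b then a + b - i else i) (by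
    intro i
    dsimp only
    split_ifs <;> omega)

/-- The sequence obtained from `(r, r - 1, …, 1)` by reversing each segment with step `ε`. -/
def reorder (r : ℕ) (m : ℕ → ℤ) (ε : ℤ) : List ℕ :=
  (List.range' 1 r).reverse.map ((segments r m ε).map fun p => omega p.1 p.2).prod

/-- The sequence `σ_m = (i_1, …, i_r)`: ascending segments are reversed. -/
def sigmaSeq (r : ℕ) (m : ℕ → ℤ) : List ℕ := reorder r m 1

/-- The sequence `τ_m = (j_1, …, j_r)`: descending segments are reversed. -/
def tauSeq (r : ℕ) (m : ℕ → ℤ) : List ℕ := reorder r m (-1)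

/-! ### Skeleton weights -/

section Weights

variable {K : Type*} [Field K]

/-- `λ_{α,n} = R_{α,n+1} / R_{α,n}`. -/
def lam (R : ℕ → ℤ → K) (α : ℕ) (n : ℤ) : K := R α (n + 1) / R α n

/-- `μ_{α,n} = R_{α,n} / R_{α-1,n}`. -/
def mu (R : ℕ → ℤ → K) (α : ℕ) (n : ℤ) : K := R α n / R (α - 1) n

/-- The weight `y_{2α-1}(m)`, `1 ≤ α ≤ r + 1`. For `α = 1` and `α = r + 1` the values `m 0` and
`m (r + 1)` do not matter, as `R 0` and `R (r + 1)` are identically `1`. -/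
def yOdd (R : ℕ → ℤ → K) (m : ℕ → ℤ) (α : ℕ) : K :=
  lam R α (m α) / lam R (α - 1) (m (α - 1))

/-- The weight `y_{2α}(m)`, `1 ≤ α ≤ r`. -/
def yEven (R : ℕ → ℤ → K) (m : ℕ → ℤ) (α : ℕ) : K :=
  mu R (α + 1) (m α + 1) / mu R α (m α) *
    (if m α = m (α + 1) + 1 then
      lam R (α + 1) (m (α + 1)) / lam R (α + 1) (m α) else 1) *
    (if m (α - 1) = m α + 1 then
      lam R (α - 1) (m α) / lam R (α - 1) (m (α - 1)) else 1)

/-- The weight `y_{a,b}(m) = ∏_{b ≤ j < a} y_{2j}(m) / ∏_{b < j < a} y_{2j-1}(m)`. -/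
def yDesc (R : ℕ → ℤ → K) (m : ℕ → ℤ) (a b : ℕ) : K :=
  (∏ j ∈ Finset.Ico b a, yEven R m j) / ∏ j ∈ Finset.Ioo b a, yOdd R m j

/-! ### The compactified graph and its transfer matrix -/

/-- There is an extra descending edge `a → b`: for a descending segment `[c, d]`, which has
`d - c + 1` vertices, all `a = c + p → b = c + q` with `0 < q + 1 < p ≤ d - c + 1`. -/
def HasDescEdge (r : ℕ) (m : ℕ → ℤ) (a b : ℕ) : Prop :=
  ∃ c d p q, IsSegment r m (-1) c d ∧ a = c + p ∧ b = c + q ∧ q + 1 < p ∧ p ≤ d - c + 1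

/-- There is an extra ascending edge `a → b`: for an ascending segment `[c, d]`,
all `a = c + q → b = c + p` with `0 < q + 1 < p ≤ d - c + 1`. -/
def HasAscEdge (r : ℕ) (m : ℕ → ℤ) (a b : ℕ) : Prop :=
  ∃ c d p q, IsSegment r m 1 c d ∧ a = c + q ∧ b = c + p ∧ q + 1 < p ∧ p ≤ d - c + 1

open Classical in
/-- The weight of the oriented edge `a → b` of the compactified graph `Γ'_m` with vertices
`1, …, r + 1` (zero if there is no such edge), as a polynomial in the formal variable `t = X`.
The summands are, in this order: the loops, the edges `a → a + 1`, the edges `b + 1 → b`, the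
extra descending edges and the extra ascending edges. At most one of them is nonzero. -/
noncomputable def edgeWeight (r : ℕ) (R : ℕ → ℤ → K) (m : ℕ → ℤ) (a b : ℕ) : K⟦X⟧ :=
  (if b = a then PowerSeries.X * PowerSeries.C (yOdd R m a) else 0) +
  (if b = a + 1 then 1 else 0) +
  (if a = b + 1 then PowerSeries.X * PowerSeries.C (yEven R m b) else 0) +
  (if HasDescEdge r m a b then PowerSeries.X * PowerSeries.C (yDesc R m a b) else 0) +
  (if HasAscEdge r m a b then (-1) ^ (b - a - 1) else 0)

/-- The compact transfer matrix `T'_m`; its entry with labels `b, a` is the weight of `a → b`. -/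
noncomputable def transfer (r : ℕ) (R : ℕ → ℤ → K) (m : ℕ → ℤ) :
    Matrix (Fin (r + 1)) (Fin (r + 1)) K⟦X⟧ :=
  Matrix.of fun p q => edgeWeight r R m (q + 1) (p + 1)

/-- The strictly lower-triangular part of a matrix. -/
def strictLower {n : ℕ} {A : Type*} [Zero A] (M : Matrix (Fin n) (Fin n) A) :
    Matrix (Fin n) (Fin n) A :=
  Matrix.of fun p q => if q < p then M p q else 0

/-- The upper-triangular part (diagonal included) of a matrix. -/
def upperPart {n : ℕ} {A : Type*} [Zero A] (M : Matrix (Fin n) (Fin n) A) :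
    Matrix (Fin n) (Fin n) A :=
  Matrix.of fun p q => if p ≤ q then M p q else 0

/-! ### Elementary matrices -/

variable (K) in
/-- The matrix unit `E_{i,j}` of size `r + 1`, `1 ≤ i, j ≤ r + 1`. -/
def unitMatrix (r i j : ℕ) : Matrix (Fin (r + 1)) (Fin (r + 1)) K :=
  Matrix.of fun p q => if (p : ℕ) + 1 = i ∧ (q : ℕ) + 1 = j then 1 else 0

/-- `f_i = I + c E_{i+1,i}`. -/
def elemF (r : ℕ) (c : K) (i : ℕ) : Matrix (Fin (r + 1)) (Fin (r + 1)) K :=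
  1 + c • unitMatrix K r (i + 1) i

/-- `e_i = I + c E_{i,i+1}`. -/
def elemE (r : ℕ) (c : K) (i : ℕ) : Matrix (Fin (r + 1)) (Fin (r + 1)) K :=
  1 + c • unitMatrix K r i (i + 1)

/-- `d_i = I + (c - 1) E_{i,i}`. -/
def elemD (r : ℕ) (c : K) (i : ℕ) : Matrix (Fin (r + 1)) (Fin (r + 1)) K :=
  1 + (c - 1) • unitMatrix K r i i

variable (K) in
/-- `F = f_{i_1} ⋯ f_{i_r}` with all parameters `1`, where `(i_1, …, i_r) = σ_m`. -/
def matF (r : ℕ) (m : ℕ → ℤ) : Matrix (Fin (r + 1)) (Fin (r + 1)) K :=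
  ((sigmaSeq r m).map fun i => elemF r (1 : K) i).prod

/-- `D = d_1 ⋯ d_{r+1}` with parameters `y_{2i-1}(m)`. -/
def matD (r : ℕ) (R : ℕ → ℤ → K) (m : ℕ → ℤ) : Matrix (Fin (r + 1)) (Fin (r + 1)) K :=
  ((List.range' 1 (r + 1)).map fun i => elemD r (yOdd R m i) i).prod

/-- `E = e_{j_1} ⋯ e_{j_r}` with parameters `y_{2i}(m) / y_{2i-1}(m)`, where
`(j_1, …, j_r) = τ_m`. -/
def matE (r : ℕ) (R : ℕ → ℤ → K) (m : ℕ → ℤ) : Matrix (Fin (r + 1)) (Fin (r + 1)) K :=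
  ((tauSeq r m).map fun i => elemE r (yEven R m i / yOdd R m i) i).prod

/-- `P_m = F D E`. -/
def matP (r : ℕ) (R : ℕ → ℤ → K) (m : ℕ → ℤ) : Matrix (Fin (r + 1)) (Fin (r + 1)) K :=
  matF K r m * matD r R m * matE r R m

variable (K) in
/-- A matrix over `K` viewed as a matrix of constant power series in `t`. -/
noncomputable def const {n : ℕ} (M : Matrix (Fin n) (Fin n) K) : Matrix (Fin n) (Fin n) K⟦X⟧ :=
  M.map PowerSeries.C

/-- The resolvent `(I - t P_m)⁻¹`. -/
noncomputable def resolventP (r : ℕ) (R : ℕ → ℤ → K) (m : ℕ → ℤ) :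
    Matrix (Fin (r + 1)) (Fin (r + 1)) K⟦X⟧ :=
  (1 - (PowerSeries.X : K⟦X⟧) • const K (matP r R m))⁻¹

/-! ### Coxeter elements and double Bruhat cells -/

/-- The simple reflection `s_i` (`1 ≤ i ≤ r`), exchanging the labels `i` and `i + 1`. -/
def simpleRefl (r i : ℕ) : Equiv.Perm (Fin (r + 1)) :=
  Equiv.swap (Fin.ofNat (r + 1) (i - 1)) (Fin.ofNat (r + 1) i)

/-- `s_{l_1} s_{l_2} ⋯`. -/
def reflProd (r : ℕ) (l : List ℕ) : Equiv.Perm (Fin (r + 1)) := (l.map (simpleRefl r)).prod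

/-- A Coxeter element of the symmetric group on `r + 1` letters: a product of all simple
reflections, each taken once, in some order. -/
def IsCoxeterElement (r : ℕ) (w : Equiv.Perm (Fin (r + 1))) : Prop :=
  ∃ l : List ℕ, l.Perm (List.range' 1 r) ∧ w = reflProd r l

variable (K) in
/-- The permutation matrix of `w`, sending the basis vector `j` to the basis vector `w j`. -/
def permMat {n : ℕ} (w : Equiv.Perm (Fin n)) : Matrix (Fin n) (Fin n) K :=
  Matrix.of fun p q => if p = w q then 1 else 0

variable (K) in
/-- The invertible upper triangular matrices. -/
def borelPlus (n : ℕ) : Set (Matrix (Fin n) (Fin n) K) :=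
  {b | (∀ p q, q < p → b p q = 0) ∧ IsUnit b.det}

variable (K) in
/-- The invertible lower triangular matrices. -/
def borelMinus (n : ℕ) : Set (Matrix (Fin n) (Fin n) K) :=
  {b | (∀ p q, p < q → b p q = 0) ∧ IsUnit b.det}

variable (K) in
/-- The double Bruhat cell `B₊ u B₊ ∩ B₋ v B₋`. -/
def doubleBruhatCell {n : ℕ} (u v : Equiv.Perm (Fin n)) : Set (Matrix (Fin n) (Fin n) K) :=
  {g | (∃ b ∈ borelPlus K n, ∃ b' ∈ borelPlus K n, g = b * permMat K u * b') ∧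
    (∃ b ∈ borelMinus K n, ∃ b' ∈ borelMinus K n, g = b * permMat K v * b')}

end Weights

end QSystem

/-! The key point is that `P_m` is a time shift. Let `gam R a k` be the minor of size `a` built from
the sequence `R 1` with its last row left free. Condensation and the `Q`-system give bilinear
relations between sizes `a` and `a + 1` (`gam_relations`). A minor vanishes when its free row
repeats a fixed one (`gam_eq_zero`), and the boundary condition `R (r+1) = 1` makes the minors of
size `r + 2` vanish identically, which closes the system at size `r + 1` (`gam_top`).

Suitably normalized and centred along the path, these minors form two row vectors w(n) = `wave` and
w'(n) = `wave'`. The relations then say w F = w' (`wave'_eq`) and w(n+1) = w(n) F D E (`wave_succ`),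
with exactly the weights `yOdd` and `yEven`. Since w(0) is the first basis row (`wave_zero`), the
(1,1) entry of P^n F is the first entry of w'(n), namely `R 1 (n + m 1 + 1) / R 1 (m 1 + 1)`.

The factorization of the transfer matrix is combinatorial. Reversing the segments controls whether
`i` precedes `i + 1` in the sequence (`reorder_split`), which gives recursions for the columns of
`F` and `E`. Solving them gives F⁻¹ = I - N and t D E = B, so that I - T' = F⁻¹ - t D E = F⁻¹ (I - t
P), from which the resolvent identity follows.

For the Bruhat cells, `F` and `D` are lower triangular and `D` and `E` upper triangular, so it is
enough to place `F` in B₊ u B₊ and `E` in B₋ v B₋. This is the length-increasing multiplication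
rule, applied one simple reflection at a time. -/

open scoped Matrix

namespace QSystem

/-! ### Minors of the sequence `R 1` with one free row -/

section LinearProblem

variable {K : Type*} [Field K] {r : ℕ} {R : ℕ → ℤ → K}

theorem IsSolution.ne_zero' (hR : IsSolution r R) {α : ℕ} (h : α ≤ r + 1) (n : ℤ) :
    R α n ≠ 0 := by
  rcases Nat.eq_zero_or_pos α with rfl | h0
  · simp [hR.bot]
  · rcases Nat.lt_or_ge r α with h1 | h1
    · obtain rfl : α = r + 1 := by omega
      simp [hR.top]
    · exact hR.ne_zero α h0 h1 n

/-- The sequences `n ↦ gam R a k n`: the Hankel-type determinant of size `a` in the sequence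
`R 1`, with rows starting at `k + 1 - a, …, k - 1` and a last row starting at `n`, computed by
condensation. -/
def gam (R : ℕ → ℤ → K) : ℕ → ℤ → ℤ → K
  | 0, _, _ => 0
  | 1, _, n => R 1 n
  | a + 2, k, n =>
    (R (a + 1) (k - 1) * gam R (a + 1) k (n + 1) - R (a + 1) k * gam R (a + 1) (k - 1) n) /
      R a (k - 1)

theorem gam_condense_right (hR : IsSolution r R) {a : ℕ} (ha : a ≤ r + 1) (k n : ℤ) :
    gam R (a + 2) k n * R a (k - 1) =
      R (a + 1) (k - 1) * gam R (a + 1) k (n + 1) - R (a + 1) k * gam R (a + 1) (k - 1) n := by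
  rw [gam, div_mul_cancel₀ _ (hR.ne_zero' ha _)]

/-- The two relations between `gam` at sizes `a + 1` and `a + 2`, and condensation from the
left. -/
theorem gam_relations (hR : IsSolution r R) (a : ℕ) :
    (a ≤ r → ∀ k n, gam R (a + 2) k n * R a k =
      R (a + 1) (k - 1) * gam R (a + 1) (k + 1) (n + 1) - R (a + 1) k * gam R (a + 1) k n) ∧
    (a + 1 ≤ r → ∀ k n, R (a + 2) k * gam R (a + 1) k n =
      gam R (a + 2) k n * R (a + 1) k - R (a + 1) (k - 1) * gam R (a + 2) (k + 1) n) ∧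
    (a + 1 ≤ r → ∀ k n, R (a + 2) k * gam R (a + 1) (k + 1) (n + 1) =
      gam R (a + 2) k n * R (a + 1) (k + 1) - R (a + 1) k * gam R (a + 2) (k + 1) n) := by
  induction a with
  | zero =>
    have hL : ∀ k n, gam R 2 k n * R 0 k =
        R 1 (k - 1) * gam R 1 (k + 1) (n + 1) - R 1 k * gam R 1 k n := by
      intro k n
      simp [gam, hR.bot]
    refine ⟨fun _ => hL, fun h k n => ?_, fun h k n => ?_⟩
    · have := hR.rec_eq 1 le_rfl h k
      simp only [zero_add, gam, hR.bot, Nat.sub_self, add_sub_cancel_right] at this ⊢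
      linear_combination (-R 1 n) * this
    · have := hR.rec_eq 1 le_rfl h k
      simp only [zero_add, gam, hR.bot, Nat.sub_self, add_sub_cancel_right] at this ⊢
      linear_combination (-R 1 (n + 1)) * this
  | succ a ih =>
    -- The last two relations at the previous size share the factor `gam R (a + 1) k (n + 1)`.
    -- Eliminating it turns condensation from the right, which is the definition, into condensation
    -- from the left.
    have hL : a + 1 ≤ r → ∀ k n, gam R (a + 3) k n * R (a + 1) k =
        R (a + 2) (k - 1) * gam R (a + 2) (k + 1) (n + 1) - R (a + 2) k * gam R (a + 2) k n := by
      intro h k n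
      have h0 := ih.2.1 h k (n + 1)
      have h1 := ih.2.2 h (k - 1) n
      have h2 := gam_condense_right hR (a := a + 1) (by omega) k n
      have hne := hR.ne_zero' (α := a + 1) (by omega) (k - 1)
      rw [sub_add_cancel] at h1
      apply mul_right_cancel₀ hne
      simp only [add_assoc, Nat.reduceAdd] at *
      linear_combination R (a + 1) k * h2 - R (a + 2) (k - 1) * h0 + R (a + 2) k * h1
    refine ⟨hL, fun h k n => ?_, fun h k n => ?_⟩
    -- After multiplying by `R (a + 1) k`, the `Q`-system replaces `R (a + 3) k * R (a + 1) k`. Left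
    -- condensation at `k` and right condensation at `k + 1` involve the same two smaller minors,
    -- one of which cancels.
    all_goals
      have hq := hR.rec_eq (a + 2) (by omega) h k
      have h1 := hL (by omega) k n
      have h2 := gam_condense_right hR (a := a + 1) (by omega) (k + 1) n
      have hne := hR.ne_zero' (α := a + 1) (by omega) k
      rw [add_sub_cancel_right] at h2
      apply mul_right_cancel₀ hne
      simp only [add_assoc, Nat.reduceAdd] at *
    · have e : a + 2 - 1 = a + 1 := by omega
      rw [e] at hq
      linear_combination (-gam R (a + 2) k n) * hq - R (a + 2) k * h1 + R (a + 2) (k - 1) * h2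
    · have e : a + 2 - 1 = a + 1 := by omega
      rw [e] at hq
      linear_combination (-gam R (a + 2) (k + 1) (n + 1)) * hq - R (a + 2) (k + 1) * h1 +
        R (a + 2) k * h2

theorem gam_condense_left (hR : IsSolution r R) {a : ℕ} (ha : a ≤ r) (k n : ℤ) :
    gam R (a + 2) k n * R a k =
      R (a + 1) (k - 1) * gam R (a + 1) (k + 1) (n + 1) - R (a + 1) k * gam R (a + 1) k n :=
  (gam_relations hR a).1 ha k n

/-- `gam R a k` vanishes at `k + 1 - a, …, k - 1`. -/
theorem gam_eq_zero (hR : IsSolution r R) {a : ℕ} (ha : a ≤ r) {k n : ℤ} (h1 : k ≤ n + a + 1)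
    (h2 : n < k) : gam R (a + 2) k n = 0 := by
  induction a generalizing k n with
  | zero =>
    obtain rfl : n = k - 1 := by push_cast at h1; omega
    simp only [gam, sub_add_cancel]
    ring
  | succ a ih =>
    -- Right condensation needs zeros at `n` for the centre `k - 1`, which excludes the last
    -- position `n = k - 1`. There condensation from the left applies instead.
    by_cases h : n = k - 1
    · have hL := gam_condense_left hR ha k n
      rw [ih (by omega) (by push_cast at h1; omega) (by omega),
        ih (by omega) (by push_cast at h1; omega) (by omega)] at hL
      simpa [hR.ne_zero' (show a + 1 ≤ r + 1 by omega) k] using hL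
    · have hL := gam_condense_right hR (a := a + 1) (by omega) k n
      rw [ih (by omega) (by push_cast at h1; omega) (by omega),
        ih (by omega) (by push_cast at h1; omega) (by omega)] at hL
      simpa [hR.ne_zero' (show a + 1 ≤ r + 1 by omega) (k - 1)] using hL

/-- The top sequences are shifts of each other. -/
theorem gam_top (hR : IsSolution r R) (k n : ℤ) :
    gam R (r + 1) (k + 1) (n + 1) = gam R (r + 1) k n := by
  -- Since `R (r + 1)` is constant, left condensation at `k` and right condensation at `k + 1` have
  -- the same right-hand side: the minor of size `r + 2` does not depend on its centre.
  have step : ∀ k n, gam R (r + 2) (k + 1) n = gam R (r + 2) k n := by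
    intro k n
    have h1 := gam_condense_left hR (le_refl r) k n
    have h2 := gam_condense_right hR (a := r) (by omega) (k + 1) n
    rw [add_sub_cancel_right] at h2
    apply mul_right_cancel₀ (hR.ne_zero' (α := r) (by omega) k)
    rw [h1, h2, hR.top, hR.top, hR.top]
  have const : ∀ k n, gam R (r + 2) k n = gam R (r + 2) (n + 1) n := by
    intro k n
    induction k using Int.induction_on generalizing n with
    | zero =>
      have aux : ∀ j : ℤ, gam R (r + 2) j n = gam R (r + 2) 0 n := by
        intro j
        induction j using Int.induction_on with
        | zero => rfl
        | succ i ih => rw [step, ih]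
        | pred i ih => rw [← ih, ← step (-i - 1), sub_add_cancel]
      exact (aux _).symm
    | succ i ih => rw [step, ih]
    | pred i ih => rw [← ih, ← step (-i - 1), sub_add_cancel]
  -- Moving the centre to `n + 1` puts `n` among the zeros, so the minor of size `r + 2` vanishes
  -- everywhere, and condensation becomes shift invariance one size below.
  have h1 := gam_condense_left hR (le_refl r) k n
  rw [const, gam_eq_zero hR le_rfl (by omega) (by omega), hR.top, hR.top, zero_mul] at h1
  linear_combination -h1

end LinearProblem

/-! ### Basis sequences adapted to the path -/

section Wave

variable {K : Type*} [Field K] {r : ℕ} {R : ℕ → ℤ → K} {m : ℕ → ℤ}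

/-- The height at which the basis sequence number `a` is centred. -/
def center (m : ℕ → ℤ) (a : ℕ) : ℤ := if m (a - 1) = m a + 1 then m a + 1 else m a

/-- The position of the first column of the determinant giving the basis sequence number `a`. -/
def offset (m : ℕ → ℤ) : ℕ → ℤ
  | 0 => m 1
  | 1 => m 1
  | a + 2 => if m (a + 2) = m (a + 1) + 1 then offset m (a + 1) else offset m (a + 1) - 1

/-- The normalization of the basis sequence number `a`. -/
def normal (R : ℕ → ℤ → K) (m : ℕ → ℤ) : ℕ → K
  | 0 => 1
  | 1 => 1
  | a + 2 => normal R m (a + 1) * R a (center m (a + 1)) *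
      R (a + 2) (if m (a + 2) = m (a + 1) + 1 then m (a + 2) else m (a + 2) + 1) /
        (R (a + 1) (m (a + 1)) * R (a + 1) (m (a + 1) + 1))

/-- The basis sequences on which the time shift acts by the matrix `P_m`. -/
def wave (R : ℕ → ℤ → K) (m : ℕ → ℤ) (a : ℕ) (n : ℤ) : K :=
  normal R m a / R a (m a) * gam R a (center m a) (n + offset m a)

/-- The image of the basis sequences under the matrix `F`. -/
def wave' (R : ℕ → ℤ → K) (m : ℕ → ℤ) (a : ℕ) (n : ℤ) : K :=
  normal R m a / R a (m a + 1) * gam R a (center m a + 1) (n + offset m a + 1)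

theorem wave_one (n : ℤ) : wave R m 1 n = R 1 (n + m 1) / R 1 (m 1) := by
  simp [wave, normal, gam, offset, div_eq_inv_mul]

theorem wave'_one (n : ℤ) :
    wave' R m 1 n = R 1 (n + m 1 + 1) / R 1 (m 1 + 1) := by
  simp [wave', normal, gam, offset, div_eq_inv_mul]

/-- The sequence numbered `a + 1` has zeros at the `a` positions just before its centre. Along a
path with steps at most one, `offset` always lands among them, because the gap between centre and
offset stays between `1` and `a`. -/
theorem wave_zero (hR : IsSolution r R) {a : ℕ} (h1 : 1 ≤ a) (ha : a ≤ r)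
    (hm : ∀ i, i ≤ r → |m i - m (i + 1)| ≤ 1) : wave R m (a + 1) 0 = 0 := by
  have key : ∀ a, 1 ≤ a → a ≤ r → center m (a + 1) - offset m (a + 1) ≤ a ∧
      0 < center m (a + 1) - offset m (a + 1) := by
    intro a h1 ha
    have hc : ∀ b, center m (b + 1) = if m b = m (b + 1) + 1 then m (b + 1) + 1 else m (b + 1) :=
      fun b => rfl
    have ho : ∀ b, offset m (b + 2) =
      if m (b + 2) = m (b + 1) + 1 then offset m (b + 1) else offset m (b + 1) - 1 :=
      fun b => rfl
    have ho1 : offset m 1 = m 1 := rfl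
    induction a, h1 using Nat.le_induction with
    | base =>
      have := abs_le.1 (hm 1 ha)
      rw [hc, ho 0]
      simp only [zero_add, ho1, Nat.reduceAdd, Nat.cast_one] at *
      split_ifs <;> omega
    | succ b hb ih =>
      obtain ⟨i1, i2⟩ := ih (by omega)
      have := abs_le.1 (hm (b + 1) ha)
      have := abs_le.1 (hm b (by omega))
      rw [hc] at i1 i2 ⊢
      rw [ho b]
      push_cast
      simp only [add_assoc, Nat.reduceAdd] at *
      split_ifs at * <;> omega
  obtain ⟨k1, k2⟩ := key a h1 ha
  obtain ⟨b, rfl⟩ : ∃ b, a = b + 1 := ⟨a - 1, by omega⟩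
  rw [wave, gam_eq_zero hR (by omega) (by push_cast at k1; omega) (by omega), mul_zero]

theorem wave'_top (hR : IsSolution r R) (n : ℤ) : wave' R m (r + 1) n = wave R m (r + 1) n := by
  rw [wave, wave', gam_top hR, hR.top, hR.top]

theorem wave_one_succ (hR : IsSolution r R) (n : ℤ) :
    wave R m 1 (n + 1) = yOdd R m 1 * wave' R m 1 n := by
  have e1 := hR.ne_zero' (α := 1) (by omega) (m 1)
  have e2 := hR.ne_zero' (α := 1) (by omega) (m 1 + 1)
  rw [wave_one, wave'_one]
  simp only [yOdd, lam, hR.bot, Nat.sub_self]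
  rw [add_right_comm]
  field_simp

/-- Condensation at centre `m (a + 1) + 1`, from the left after a descent and from the right
otherwise. The next step of the path decides whether the larger minor is an entry of `wave` or of
`wave'`. This is the recursion satisfied by the columns of `F`. -/
theorem wave'_eq (hR : IsSolution r R) (hm : ∀ i, i ≤ r → |m i - m (i + 1)| ≤ 1)
    {a : ℕ} (ha : a + 1 ≤ r) (n : ℤ) :
    wave' R m (a + 1) n = wave R m (a + 1) n +
      if m (a + 2) = m (a + 1) + 1 then wave R m (a + 2) n else wave' R m (a + 2) n := by
  have key : ∀ n', gam R (a + 2) (m (a + 1) + 1) n' * R a (center m (a + 1)) =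
      R (a + 1) (m (a + 1)) * gam R (a + 1) (center m (a + 1) + 1) (n' + 1) -
        R (a + 1) (m (a + 1) + 1) * gam R (a + 1) (center m (a + 1)) n' := by
    intro n'
    simp only [center, Nat.add_sub_cancel]
    split_ifs with h
    · have := gam_condense_left hR (a := a) (by omega) (m (a + 1) + 1) n'
      rwa [add_sub_cancel_right] at this
    · have := gam_condense_right hR (a := a) (by omega) (m (a + 1) + 1) n'
      rwa [add_sub_cancel_right] at this
  have n1 := hR.ne_zero' (α := a + 1) (by omega) (m (a + 1))
  have n2 := hR.ne_zero' (α := a + 1) (by omega) (m (a + 1) + 1)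
  have n3 := hR.ne_zero' (α := a + 2) (by omega) (m (a + 2))
  have n4 := hR.ne_zero' (α := a + 2) (by omega) (m (a + 2) + 1)
  have k := key (n + offset m (a + 1))
  have hb := abs_le.1 (hm (a + 1) ha)
  simp only [add_assoc, Nat.reduceAdd] at hb
  split_ifs with h
  · have c : center m (a + 2) = m (a + 1) + 1 := by
      simp only [center, Nat.add_succ_sub_one]; split_ifs <;> omega
    have o : offset m (a + 2) = offset m (a + 1) := by rw [offset, if_pos h]
    rw [wave', wave, wave, normal, if_pos h, c, o]
    field_simp
    linear_combination -(normal R m (a + 1)) * k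
  · have c : center m (a + 2) = m (a + 1) := by
      simp only [center, Nat.add_succ_sub_one]; split_ifs <;> omega
    have o : n + offset m (a + 2) + 1 = n + offset m (a + 1) := by
      rw [offset, if_neg h]; ring
    rw [wave', wave, wave', normal, if_neg h, c, o]
    field_simp
    linear_combination -(normal R m (a + 1)) * k

/-- Counterpart of `wave'_eq` for the matrix `D E`: it rests on the two relations raising the size,
and its case distinction is that of the columns of `E`. -/
theorem wave_succ (hR : IsSolution r R) (hm : ∀ i, i ≤ r → |m i - m (i + 1)| ≤ 1)
    {a : ℕ} (ha : a + 1 ≤ r) (n : ℤ) :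
    wave R m (a + 2) (n + 1) = yOdd R m (a + 2) * wave' R m (a + 2) n +
      if m a = m (a + 1) + 1 then
        yEven R m (a + 1) / yOdd R m (a + 1) * wave R m (a + 1) (n + 1)
      else yEven R m (a + 1) * wave' R m (a + 1) n := by
  have hb := abs_le.1 (hm (a + 1) ha)
  simp only [add_assoc, Nat.reduceAdd] at hb
  -- After a descent, the centre of sequence `a + 1` is already `m (a + 1) + 1`, so `wave` at time
  -- `n + 1` and, otherwise, `wave'` at time `n` contain the same minor `z`. The two branches thus
  -- differ only by normalization.
  obtain ⟨z, hz⟩ : ∃ z, gam R (a + 1) (m (a + 1) + 1) (n + offset m (a + 1) + 1) = z := ⟨_, rfl⟩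
  have key : R (a + 2) (if m (a + 2) = m (a + 1) + 1 then m (a + 1) + 1 else m (a + 1)) * z =
      gam R (a + 2) (center m (a + 2)) (n + offset m (a + 2) + 1) * R (a + 1) (m (a + 1) + 1) -
        R (a + 1) (m (a + 1)) *
          gam R (a + 2) (center m (a + 2) + 1) (n + offset m (a + 2) + 1) := by
    rw [← hz]
    split_ifs with h
    · have c : center m (a + 2) = m (a + 1) + 1 := by
        simp only [center, Nat.add_succ_sub_one]; split_ifs <;> omega
      have o : offset m (a + 2) = offset m (a + 1) := by rw [offset, if_pos h]
      have := (gam_relations hR a).2.1 ha (m (a + 1) + 1) (n + offset m (a + 1) + 1)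
      rw [add_sub_cancel_right] at this
      rw [c, o, this]
    · have c : center m (a + 2) = m (a + 1) := by
        simp only [center, Nat.add_succ_sub_one]; split_ifs <;> omega
      have o : n + offset m (a + 2) + 1 = n + offset m (a + 1) := by
        rw [offset, if_neg h]; ring
      have := (gam_relations hR a).2.2 ha (m (a + 1)) (n + offset m (a + 1))
      rw [c, o, this]
  have n0 : ∀ k, R a k ≠ 0 := hR.ne_zero' (by omega)
  have n1 : ∀ k, R (a + 1) k ≠ 0 := hR.ne_zero' (by omega)
  have n2 : ∀ k, R (a + 2) k ≠ 0 := hR.ne_zero' (by omega)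
  have hw : (if m a = m (a + 1) + 1 then
        yEven R m (a + 1) / yOdd R m (a + 1) * wave R m (a + 1) (n + 1)
      else yEven R m (a + 1) * wave' R m (a + 1) n) =
      normal R m (a + 2) / R (a + 2) (m (a + 2)) *
        (R (a + 2) (if m (a + 2) = m (a + 1) + 1 then m (a + 1) + 1 else m (a + 1)) * z) /
        R (a + 1) (m (a + 1) + 1) := by
    rw [← hz]
    simp only [wave, wave', normal, yEven, yOdd, lam, mu, center, Nat.add_succ_sub_one,
      add_assoc, Nat.reduceAdd, add_tsub_cancel_right]
    rw [show n + (1 + offset m (a + 1)) = n + (offset m (a + 1) + 1) by ring]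
    -- Three slopes after `a + 1`, times descent or not before it: in each of the six cases the
    -- correction factors in `yEven` cancel against the normalizations.
    obtain h2 | h2 | h2 : m (a + 2) = m (a + 1) + 1 ∨ m (a + 2) = m (a + 1) ∨
        m (a + 2) = m (a + 1) - 1 := by omega
    all_goals
      simp only [h2]
      by_cases h1 : m a = m (a + 1) + 1
      all_goals
        simp only [h1, if_true, if_false, left_eq_add, one_ne_zero, sub_eq_add_neg,
          add_right_inj, add_assoc, Int.reduceAdd, add_zero, Int.reduceNeg, Int.reduceEq,
          neg_add_cancel]
        have := n0 (m (a + 1) + 1)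
        have := n0 (m (a + 1) + 2)
        have := n0 (m (a + 1))
        have := n1 (m (a + 1))
        have := n1 (m (a + 1) + 1)
        have := n2 (m (a + 1))
        have := n2 (m (a + 1) + 1)
        have := n2 (m (a + 1) + -1)
        have := n2 (m (a + 1) + 2)
        have := n0 (m a)
        have := n0 (m a + 1)
        field_simp
  rw [hw, key, wave, wave', show n + 1 + offset m (a + 2) = n + offset m (a + 2) + 1 by ring]
  simp only [yOdd, lam, Nat.add_succ_sub_one]
  have := n1 (m (a + 1))
  have := n1 (m (a + 1) + 1)
  have := n2 (m (a + 2))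
  have := n2 (m (a + 2) + 1)
  field_simp
  ring

end Wave

/-! ### Relative order of neighbours after reversing segments -/

section Reorder

variable {r : ℕ} {m : ℕ → ℤ} {ε : ℤ}

/-- The step from `i` to `i + 1` is a step of the path, and it is equal to `ε`. -/
def IsStep (r : ℕ) (m : ℕ → ℤ) (ε : ℤ) (i : ℕ) : Prop := 1 ≤ i ∧ i < r ∧ m (i + 1) = m i + ε

instance (i : ℕ) : Decidable (IsStep r m ε i) := by unfold IsStep; infer_instance

theorem IsSegment.isStep {a b : ℕ} (h : IsSegment r m ε a b) {k : ℕ} (h1 : a ≤ k) (h2 : k < b) :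
    IsStep r m ε k :=
  ⟨h.1.trans h1, h2.trans_le h.2.2.1, h.2.2.2.1 k h2 h1⟩

theorem IsSegment.not_isStep_pred {a b : ℕ} (h : IsSegment r m ε a b) :
    ¬ IsStep r m ε (a - 1) := by
  rintro ⟨h1, -, h3⟩
  obtain ha | ha := h.2.2.2.2.1
  · omega
  · rw [Nat.sub_add_cancel h.1] at h3
    exact ha h3

theorem IsSegment.not_isStep {a b : ℕ} (h : IsSegment r m ε a b) : ¬ IsStep r m ε b := by
  rintro ⟨-, h2, h3⟩
  obtain hb | hb := h.2.2.2.2.2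
  · omega
  · exact hb h3

theorem IsSegment.start_le {a b a' b' : ℕ} (h : IsSegment r m ε a b) (h' : IsSegment r m ε a' b')
    (hle : a ≤ b') : a ≤ a' := by
  by_contra hlt
  exact h.not_isStep_pred (h'.isStep (by omega) (by omega))

theorem IsSegment.le_end {a b a' b' : ℕ} (h : IsSegment r m ε a b) (h' : IsSegment r m ε a' b')
    (hle : a' ≤ b) : b' ≤ b := by
  by_contra hlt
  exact h.not_isStep (h'.isStep hle (by omega))

/-- If two maximal segments of the same slope overlapped, one could be prolonged past an end.
Disjointness lets the product of the reversals be evaluated segment by segment. -/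
theorem IsSegment.eq_of_mem {a b a' b' i : ℕ} (h : IsSegment r m ε a b)
    (h' : IsSegment r m ε a' b') (h1 : a ≤ i) (h2 : i ≤ b) (h3 : a' ≤ i) (h4 : i ≤ b') :
    a = a' ∧ b = b' :=
  ⟨le_antisymm (h.start_le h' (by omega)) (h'.start_le h (by omega)),
    le_antisymm (h'.le_end h (by omega)) (h.le_end h' (by omega))⟩

/-- Every interval of steps `ε` is contained in a maximal segment. -/
theorem exists_isSegment {i j : ℕ} (hij : i < j) (h : ∀ k, i ≤ k → k < j → IsStep r m ε k) :
    ∃ a b, IsSegment r m ε a b ∧ a ≤ i ∧ j ≤ b := by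
  have hex : ∃ a, ∀ k, a ≤ k → k < j → IsStep r m ε k := ⟨i, h⟩
  have hex' : ∃ b, j ≤ b ∧ ¬ IsStep r m ε b :=
    ⟨max j r, le_max_left _ _, fun hs => absurd hs.2.1 (by simp)⟩
  classical
  obtain ⟨a, ha, ha'⟩ : ∃ a, (∀ k, a ≤ k → k < j → IsStep r m ε k) ∧
      ∀ a' < a, ¬ ∀ k, a' ≤ k → k < j → IsStep r m ε k :=
    ⟨Nat.find hex, Nat.find_spec hex, fun a' h => Nat.find_min hex h⟩
  obtain ⟨b, hb, hb'⟩ : ∃ b, (j ≤ b ∧ ¬ IsStep r m ε b) ∧ ∀ k < b, ¬ (j ≤ k ∧ ¬ IsStep r m ε k) :=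
    ⟨Nat.find hex', Nat.find_spec hex', fun a' h => Nat.find_min hex' h⟩
  have hai : a ≤ i := by
    by_contra hlt
    exact ha' i (by omega) h
  have hstep : ∀ k, a ≤ k → k < b → IsStep r m ε k := by
    intro k h1 h2
    by_cases hk : k < j
    · exact ha k h1 hk
    · by_contra hs
      exact hb' k h2 ⟨by omega, hs⟩
  have h1a := (hstep a le_rfl (by omega)).1
  have hbr := (hstep (b - 1) (by omega) (by omega)).2.1
  refine ⟨a, b, ⟨h1a, by omega, by omega, fun k h1 h2 => (hstep k h2 h1).2.2, ?_, ?_⟩, hai, hb.1⟩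
  · by_contra hcon
    push Not at hcon
    refine ha' (a - 1) (by omega) fun k h1 h2 => ?_
    by_cases hk : k = a - 1
    · subst hk
      exact ⟨by omega, by omega, by rw [Nat.sub_add_cancel h1a]; exact hcon.2⟩
    · exact ha k (by omega) h2
  · by_contra hcon
    push Not at hcon
    exact hb.2 ⟨by omega, by omega, hcon.2⟩

theorem mem_segments {p : ℕ × ℕ} : p ∈ segments r m ε ↔ IsSegment r m ε p.1 p.2 := by
  simp only [segments, List.mem_filter, decide_eq_true_eq, and_iff_right_iff_imp]
  intro h
  obtain ⟨h1, h2, h3, -⟩ := h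
  obtain ⟨a, b⟩ := p
  simp only at h1 h2 h3
  rw [List.mem_product, List.mem_range'_1, List.mem_range'_1]
  omega

theorem nodup_segments : (segments r m ε).Nodup :=
  ((List.nodup_range').product (List.nodup_range')).filter _

theorem omega_apply (a b i : ℕ) : omega a b i = if a ≤ i ∧ i ≤ b then a + b - i else i := rfl

theorem omegaProd_of_not_mem {L : List (ℕ × ℕ)} {i : ℕ}
    (h : ∀ p ∈ L, ¬ (p.1 ≤ i ∧ i ≤ p.2)) : (L.map fun p => omega p.1 p.2).prod i = i := by
  induction L with
  | nil => rfl
  | cons q L ih =>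
    rw [List.map_cons, List.prod_cons, Equiv.Perm.mul_apply,
      ih fun p hp => h p (List.mem_cons_of_mem _ hp), omega_apply, if_neg (h q List.mem_cons_self)]

theorem omegaProd_of_mem {L : List (ℕ × ℕ)} (hL : ∀ p ∈ L, IsSegment r m ε p.1 p.2)
    (hn : L.Nodup) {p : ℕ × ℕ} (hp : p ∈ L) {i : ℕ} (h1 : p.1 ≤ i) (h2 : i ≤ p.2) :
    (L.map fun p => omega p.1 p.2).prod i = p.1 + p.2 - i := by
  induction L with
  | nil => simp at hp
  | cons q L ih =>
    rw [List.nodup_cons] at hn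
    have hdis : ∀ p' ∈ L, ∀ x, q.1 ≤ x → x ≤ q.2 → ¬ (p'.1 ≤ x ∧ x ≤ p'.2) := by
      intro p' hp' x hx1 hx2 hx
      have := (hL q List.mem_cons_self).eq_of_mem (hL p' (List.mem_cons_of_mem _ hp'))
        hx1 hx2 hx.1 hx.2
      exact hn.1 (Prod.ext this.1 this.2 ▸ hp')
    rw [List.map_cons, List.prod_cons, Equiv.Perm.mul_apply]
    rcases List.mem_cons.1 hp with rfl | hp
    · rw [omegaProd_of_not_mem fun p' hp' => hdis p' hp' i h1 h2, omega_apply, if_pos ⟨h1, h2⟩]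
    · rw [ih (fun p hp => hL p (List.mem_cons_of_mem _ hp)) hn.2 hp, omega_apply, if_neg]
      intro hx
      exact hdis p hp _ hx.1 hx.2 ⟨by omega, by omega⟩

/-- The permutation reversing every segment with step `ε`. -/
def segPerm (r : ℕ) (m : ℕ → ℤ) (ε : ℤ) : Equiv.Perm ℕ :=
  ((segments r m ε).map fun p => omega p.1 p.2).prod

theorem segPerm_of_isSegment {a b : ℕ} (h : IsSegment r m ε a b) {i : ℕ} (h1 : a ≤ i)
    (h2 : i ≤ b) : segPerm r m ε i = a + b - i :=
  omegaProd_of_mem (p := (a, b)) (fun _ => mem_segments.1) nodup_segments (mem_segments.2 h) h1 h2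

theorem segPerm_of_not_mem {i : ℕ} (h : ∀ a b, IsSegment r m ε a b → ¬ (a ≤ i ∧ i ≤ b)) :
    segPerm r m ε i = i :=
  omegaProd_of_not_mem fun p hp => h p.1 p.2 (mem_segments.1 hp)

theorem segPerm_segPerm (i : ℕ) : segPerm r m ε (segPerm r m ε i) = i := by
  by_cases h : ∃ a b, IsSegment r m ε a b ∧ a ≤ i ∧ i ≤ b
  · obtain ⟨a, b, h, h1, h2⟩ := h
    rw [segPerm_of_isSegment h h1 h2, segPerm_of_isSegment h (by omega) (by omega)]
    omega
  · have : segPerm r m ε i = i :=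
      segPerm_of_not_mem fun a b hs hi => h ⟨a, b, hs, hi⟩
    rw [this, this]

theorem segPerm_mem {i : ℕ} (h1 : 1 ≤ i) (h2 : i ≤ r) :
    1 ≤ segPerm r m ε i ∧ segPerm r m ε i ≤ r := by
  by_cases h : ∃ a b, IsSegment r m ε a b ∧ a ≤ i ∧ i ≤ b
  · obtain ⟨a, b, h, h1, h2⟩ := h
    rw [segPerm_of_isSegment h h1 h2]
    have := h.1
    have := h.2.2.1
    omega
  · rw [segPerm_of_not_mem fun a b hs hi => h ⟨a, b, hs, hi⟩]
    exact ⟨h1, h2⟩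

theorem segPerm_succ_lt {i : ℕ} (h : IsStep r m ε i) :
    segPerm r m ε (i + 1) < segPerm r m ε i := by
  obtain ⟨a, b, hs, ha, hb⟩ := exists_isSegment (i := i) (j := i + 1) (by omega)
    fun k h1 h2 => by obtain rfl : k = i := by omega
                      exact h
  rw [segPerm_of_isSegment hs (by omega) hb, segPerm_of_isSegment hs ha (by omega)]
  omega

/-- If `i` is not a step, `i` can only be the right end of a segment and `i + 1` only the left end
of one. Reversal then moves `i` weakly left and `i + 1` weakly right. -/
theorem lt_segPerm_succ {i : ℕ} (h : ¬ IsStep r m ε i) :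
    segPerm r m ε i < segPerm r m ε (i + 1) := by
  have h1 : segPerm r m ε i ≤ i := by
    by_cases hs : ∃ a b, IsSegment r m ε a b ∧ a ≤ i ∧ i ≤ b
    · obtain ⟨a, b, hs, h1, h2⟩ := hs
      have : i = b := by
        by_contra hne
        exact h (hs.isStep h1 (by omega))
      rw [segPerm_of_isSegment hs h1 h2]
      omega
    · exact (segPerm_of_not_mem fun a b hs' hi => hs ⟨a, b, hs', hi⟩).le
  have h2 : i + 1 ≤ segPerm r m ε (i + 1) := by
    by_cases hs : ∃ a b, IsSegment r m ε a b ∧ a ≤ i + 1 ∧ i + 1 ≤ b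
    · obtain ⟨a, b, hs, h1, h2⟩ := hs
      have : i + 1 = a := by
        by_contra hne
        exact h (hs.isStep (by omega) (by omega))
      rw [segPerm_of_isSegment hs h1 h2]
      omega
    · exact (segPerm_of_not_mem fun a b hs' hi => hs ⟨a, b, hs', hi⟩).ge
  omega

theorem mem_reorder {i : ℕ} : i ∈ reorder r m ε ↔ 1 ≤ i ∧ i ≤ r := by
  constructor
  · intro h
    obtain ⟨x, hx, rfl⟩ := List.mem_map.1 h
    rw [List.mem_reverse, List.mem_range'_1] at hx
    exact segPerm_mem hx.1 (by omega)
  · rintro ⟨h1, h2⟩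
    refine List.mem_map.2 ⟨segPerm r m ε i, ?_, segPerm_segPerm i⟩
    have := segPerm_mem (m := m) (ε := ε) h1 h2
    rw [List.mem_reverse, List.mem_range'_1]
    omega

theorem nodup_reorder : (reorder r m ε).Nodup :=
  (List.nodup_reverse.2 List.nodup_range').map (Equiv.injective _)

theorem reorder_perm : (reorder r m ε).Perm (List.range' 1 r) := by
  rw [List.perm_ext_iff_of_nodup nodup_reorder List.nodup_range']
  intro i
  rw [mem_reorder, List.mem_range'_1]
  omega

/-- In the reordered sequence, `i` precedes `i + 1` exactly when the step from `i` to `i + 1`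
is `ε`. -/
theorem reorder_split {i : ℕ} (h1 : 1 ≤ i) (h2 : i ≤ r) :
    ∃ l₁ l₂, reorder r m ε = l₁ ++ i :: l₂ ∧ i ∉ l₁ ∧ i ∉ l₂ ∧
      (IsStep r m ε i → i + 1 ∉ l₁) ∧ (¬ IsStep r m ε i → i + 1 ∉ l₂) ∧
      (IsStep r m ε (i - 1) → i - 1 ∉ l₂) ∧ (¬ IsStep r m ε (i - 1) → i - 1 ∉ l₁) := by
  -- `x` is the entry of the decreasing list that is sent to `i`. As `segPerm` is an involution, `j`
  -- stands before `i` exactly when `segPerm r m ε j` exceeds `x`.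
  obtain ⟨x, hx⟩ : ∃ x, segPerm r m ε i = x := ⟨_, rfl⟩
  have hxi : segPerm r m ε x = i := by rw [← hx, segPerm_segPerm]
  have hxr := hx ▸ segPerm_mem (m := m) (ε := ε) h1 h2
  have hr : List.range' 1 r = List.range' 1 (x - 1) ++ x :: List.range' (x + 1) (r - x) := by
    rw [← List.range'_succ, show x = 1 + 1 * (x - 1) by omega,
      show r = (x - 1) + (r - x + 1) by omega, ← List.range'_append]
    congr 2 <;> omega
  have m1 : ∀ j, j ∈ (List.range' (x + 1) (r - x)).reverse.map (segPerm r m ε) →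
      x < segPerm r m ε j := by
    intro j hj
    obtain ⟨y, hy, rfl⟩ := List.mem_map.1 hj
    rw [List.mem_reverse, List.mem_range'_1] at hy
    rw [segPerm_segPerm]
    omega
  have m2 : ∀ j, j ∈ (List.range' 1 (x - 1)).reverse.map (segPerm r m ε) →
      segPerm r m ε j < x := by
    intro j hj
    obtain ⟨y, hy, rfl⟩ := List.mem_map.1 hj
    rw [List.mem_reverse, List.mem_range'_1] at hy
    rw [segPerm_segPerm]
    omega
  refine ⟨(List.range' (x + 1) (r - x)).reverse.map (segPerm r m ε),
    (List.range' 1 (x - 1)).reverse.map (segPerm r m ε), ?_, ?_, ?_, ?_, ?_, ?_, ?_⟩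
  · rw [show reorder r m ε = (List.range' 1 r).reverse.map (segPerm r m ε) from rfl, hr]
    simp [hxi]
  · intro h; have := m1 _ h; omega
  · intro h; have := m2 _ h; omega
  · intro hs h; have := m1 _ h; have := segPerm_succ_lt hs; omega
  · intro hs h; have := m2 _ h; have := lt_segPerm_succ hs; omega
  · intro hs h; have := m2 _ h; have := segPerm_succ_lt hs
    rw [Nat.sub_add_cancel h1] at this; omega
  · intro hs h; have := m1 _ h; have := lt_segPerm_succ hs
    rw [Nat.sub_add_cancel h1] at this; omega

end Reorder

/-! ### Column recursions for the elementary products -/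

section Columns

variable {K : Type*} [Field K] {r : ℕ} {R : ℕ → ℤ → K} {m : ℕ → ℤ}

variable (K) in
/-- The basis vector with label `j`. -/
def ev (r j : ℕ) : Fin (r + 1) → K := fun p => if (p : ℕ) + 1 = j then 1 else 0

theorem dotProduct_ev {j : ℕ} (h : j ≤ r) (v : Fin (r + 1) → K) :
    v ⬝ᵥ ev K r (j + 1) = v ⟨j, by omega⟩ := by
  have : ev K r (j + 1) = Pi.single ⟨j, by omega⟩ 1 := by
    ext p
    simp [ev, Pi.single_apply, Fin.ext_iff]
  rw [this, dotProduct_single_one]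

theorem mulVec_ev (M : Matrix (Fin (r + 1)) (Fin (r + 1)) K) (p q : Fin (r + 1)) :
    (M *ᵥ ev K r (q + 1)) p = M p q :=
  dotProduct_ev (Nat.lt_succ_iff.1 q.2) _

theorem ext_ev {M N : Matrix (Fin (r + 1)) (Fin (r + 1)) K}
    (h : ∀ j, j ≤ r → M *ᵥ ev K r (j + 1) = N *ᵥ ev K r (j + 1)) : M = N := by
  ext p q
  rw [← mulVec_ev M, ← mulVec_ev N, h q (by omega)]

theorem unitMatrix_mulVec_ev (i j : ℕ) {k : ℕ} (h0 : 1 ≤ k) (h : k ≤ r + 1) :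
    unitMatrix K r i j *ᵥ ev K r k = if k = j then ev K r i else 0 := by
  obtain ⟨k, rfl⟩ : ∃ k', k = k' + 1 := ⟨k - 1, by omega⟩
  ext p
  rw [Matrix.mulVec, dotProduct_ev (by omega)]
  rw [apply_ite (fun v : Fin (r + 1) → K => v p)]
  simp only [unitMatrix, Matrix.of_apply, ev, Pi.zero_apply]
  split_ifs <;> simp_all

theorem elemF_mulVec_ev (c : K) (i : ℕ) {j : ℕ} (h0 : 1 ≤ j) (h : j ≤ r + 1) :
    elemF r c i *ᵥ ev K r j = ev K r j + if j = i then c • ev K r (i + 1) else 0 := by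
  rw [elemF, Matrix.add_mulVec, Matrix.one_mulVec, Matrix.smul_mulVec,
    unitMatrix_mulVec_ev _ _ h0 h]
  split_ifs <;> simp

theorem elemE_mulVec_ev (c : K) (i : ℕ) {j : ℕ} (h0 : 1 ≤ j) (h : j ≤ r + 1) :
    elemE r c i *ᵥ ev K r j = ev K r j + if j = i + 1 then c • ev K r i else 0 := by
  rw [elemE, Matrix.add_mulVec, Matrix.one_mulVec, Matrix.smul_mulVec,
    unitMatrix_mulVec_ev _ _ h0 h]
  split_ifs <;> simp

theorem elemD_mulVec_ev (c : K) (i : ℕ) {j : ℕ} (h0 : 1 ≤ j) (h : j ≤ r + 1) :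
    elemD r c i *ᵥ ev K r j = if j = i then c • ev K r j else ev K r j := by
  rw [elemD, Matrix.add_mulVec, Matrix.one_mulVec, Matrix.smul_mulVec,
    unitMatrix_mulVec_ev _ _ h0 h]
  split_ifs with h
  · subst h
    rw [sub_smul, one_smul, add_sub_cancel]
  · simp

theorem prod_mulVec_of_fixed {M : ℕ → Matrix (Fin (r + 1)) (Fin (r + 1)) K} {l : List ℕ}
    {v : Fin (r + 1) → K} (h : ∀ i ∈ l, M i *ᵥ v = v) : (l.map M).prod *ᵥ v = v := by
  induction l with
  | nil => simp
  | cons i l ih =>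
    rw [List.map_cons, List.prod_cons, ← Matrix.mulVec_mulVec,
      ih fun j hj => h j (List.mem_cons_of_mem _ hj), h i List.mem_cons_self]

theorem prodF_mulVec_of_not_mem (c : ℕ → K) {l : List ℕ} {j : ℕ} (h0 : 1 ≤ j) (h : j ≤ r + 1)
    (hl : j ∉ l) : (l.map fun i => elemF r (c i) i).prod *ᵥ ev K r j = ev K r j := by
  refine prod_mulVec_of_fixed fun i hi => ?_
  rw [elemF_mulVec_ev _ _ h0 h, if_neg (by rintro rfl; exact hl hi), add_zero]

theorem prodE_mulVec_of_not_mem (c : ℕ → K) {l : List ℕ} {j : ℕ} (h : j ≤ r)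
    (hl : j ∉ l) : (l.map fun i => elemE r (c i) i).prod *ᵥ ev K r (j + 1) = ev K r (j + 1) := by
  refine prod_mulVec_of_fixed fun i hi => ?_
  rw [elemE_mulVec_ev _ _ (by omega) (by omega), if_neg, add_zero]
  intro hij
  exact hl (by rwa [Nat.add_right_cancel hij])

/-- Only the factor `f_i` moves `ev i`, creating a term `ev (i + 1)` on which the factors to its
left still act. These contain `f_{i+1}` unless the step is ascending, and in that case they act on
`ev (i + 1)` as all of `F` does. -/
theorem matF_mulVec_ev {i : ℕ} (h1 : 1 ≤ i) (h2 : i ≤ r) :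
    matF K r m *ᵥ ev K r i = ev K r i +
      if IsStep r m 1 i then ev K r (i + 1) else matF K r m *ᵥ ev K r (i + 1) := by
  obtain ⟨l₁, l₂, h, hi1, hi2, hs, hs', -⟩ := reorder_split (m := m) (ε := 1) h1 h2
  have e : matF K r m = (l₁.map fun i => elemF r (1 : K) i).prod * (elemF r 1 i *
      (l₂.map fun i => elemF r (1 : K) i).prod) := by
    rw [matF, sigmaSeq, h, List.map_append, List.prod_append, List.map_cons, List.prod_cons]
  have hstep : (if IsStep r m 1 i then ev K r (i + 1) else matF K r m *ᵥ ev K r (i + 1)) =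
      (l₁.map fun i => elemF r (1 : K) i).prod *ᵥ ev K r (i + 1) := by
    split_ifs with hst
    · rw [prodF_mulVec_of_not_mem (fun _ => 1) (by omega) (by omega) (hs hst)]
    · rw [e, ← Matrix.mulVec_mulVec, ← Matrix.mulVec_mulVec,
        prodF_mulVec_of_not_mem (fun _ => 1) (by omega) (by omega) (hs' hst),
        elemF_mulVec_ev _ _ (by omega) (by omega), if_neg (by omega), add_zero]
  rw [hstep, e, ← Matrix.mulVec_mulVec, ← Matrix.mulVec_mulVec,
    prodF_mulVec_of_not_mem (fun _ => 1) h1 (by omega) hi2, elemF_mulVec_ev _ _ h1 (by omega),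
    if_pos rfl, one_smul, Matrix.mulVec_add,
    prodF_mulVec_of_not_mem (fun _ => 1) h1 (by omega) hi1]

theorem matF_mulVec_ev_top : matF K r m *ᵥ ev K r (r + 1) = ev K r (r + 1) :=
  prodF_mulVec_of_not_mem (fun _ => 1) (by omega) le_rfl fun h => by
    have := (mem_reorder.1 h).2
    omega

theorem matE_mulVec_ev_one : matE r R m *ᵥ ev K r 1 = ev K r 1 :=
  prodE_mulVec_of_not_mem (fun i => yEven R m i / yOdd R m i) (Nat.zero_le _) fun h => by
    have := (mem_reorder.1 h).1
    omega

/-- Mirror image of `matF_mulVec_ev`: here the label drops, and `e_{i-1}` stands to the left of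
`e_i` exactly at a descending step. -/
theorem matE_mulVec_ev {i : ℕ} (h1 : 1 ≤ i) (h2 : i ≤ r) :
    matE r R m *ᵥ ev K r (i + 1) = ev K r (i + 1) + (yEven R m i / yOdd R m i) •
      if IsStep r m (-1) (i - 1) then matE r R m *ᵥ ev K r i else ev K r i := by
  obtain ⟨l₁, l₂, h, hi1, hi2, -, -, hs, hs'⟩ := reorder_split (m := m) (ε := -1) h1 h2
  have e : matE r R m = (l₁.map fun i => elemE r (yEven R m i / yOdd R m i) i).prod *
      (elemE r (yEven R m i / yOdd R m i) i *
      (l₂.map fun i => elemE r (yEven R m i / yOdd R m i) i).prod) := by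
    rw [matE, tauSeq, h, List.map_append, List.prod_append, List.map_cons, List.prod_cons]
  obtain ⟨k, rfl⟩ : ∃ k, i = k + 1 := ⟨i - 1, by omega⟩
  rw [Nat.add_sub_cancel] at *
  have hstep : (if IsStep r m (-1) k then matE r R m *ᵥ ev K r (k + 1) else ev K r (k + 1)) =
      (l₁.map fun i => elemE r (yEven R m i / yOdd R m i) i).prod *ᵥ ev K r (k + 1) := by
    split_ifs with hst
    · rw [e, ← Matrix.mulVec_mulVec, ← Matrix.mulVec_mulVec,
        prodE_mulVec_of_not_mem (fun i => yEven R m i / yOdd R m i) (by omega) (hs hst),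
        elemE_mulVec_ev _ _ (by omega) (by omega), if_neg (by omega), add_zero]
    · rw [prodE_mulVec_of_not_mem (fun i => yEven R m i / yOdd R m i) (by omega) (hs' hst)]
  rw [hstep, e, ← Matrix.mulVec_mulVec, ← Matrix.mulVec_mulVec,
    prodE_mulVec_of_not_mem (fun i => yEven R m i / yOdd R m i) h2 hi2,
    elemE_mulVec_ev _ _ (by omega) (by omega), if_pos rfl, Matrix.mulVec_add, Matrix.mulVec_smul,
    prodE_mulVec_of_not_mem (fun i => yEven R m i / yOdd R m i) h2 hi1]

theorem matD_mulVec_ev {j : ℕ} (h1 : 1 ≤ j) (h2 : j ≤ r + 1) :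
    matD r R m *ᵥ ev K r j = yOdd R m j • ev K r j := by
  have key : ∀ l : List ℕ, l.Nodup → (l.map fun i => elemD r (yOdd R m i) i).prod *ᵥ ev K r j =
      (if j ∈ l then yOdd R m j else 1) • ev K r j := by
    intro l hl
    induction l with
    | nil => simp
    | cons i l ih =>
      rw [List.nodup_cons] at hl
      rw [List.map_cons, List.prod_cons, ← Matrix.mulVec_mulVec, ih hl.2, Matrix.mulVec_smul,
        elemD_mulVec_ev _ _ h1 h2]
      by_cases hij : j = i
      · subst hij
        simp [hl.1]
      · simp [hij]
  rw [matD, key _ List.nodup_range', if_pos]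
  rw [List.mem_range'_1]
  omega

/-! ### The triangular parts of the transfer matrix -/

/-- All steps from `a` to `b - 1` are equal to `ε`. -/
def IsChain (r : ℕ) (m : ℕ → ℤ) (ε : ℤ) (a b : ℕ) : Prop :=
  ∀ k, a ≤ k → k + 1 < b → IsStep r m ε k

noncomputable instance (ε : ℤ) (a b : ℕ) : Decidable (IsChain r m ε a b) := Classical.dec _

/-- Vacuous, because extra edges reach one vertex beyond the end of a segment and a chain therefore
omits the last step. Nearest-neighbour edges thus obey the same formula as the extra ones. -/
theorem isChain_of_le {ε : ℤ} {a b : ℕ} (h : b ≤ a + 1) : IsChain r m ε a b := by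
  intro k h1 h2
  omega

theorem isChain_iff_left {ε : ℤ} {a b : ℕ} (h : a + 1 < b) :
    IsChain r m ε a b ↔ IsStep r m ε a ∧ IsChain r m ε (a + 1) b := by
  constructor
  · intro hc
    exact ⟨hc _ le_rfl h, fun j h1 h2 => hc j (by omega) h2⟩
  · rintro ⟨hs, hc⟩ j h1 h2
    by_cases hj : j = a
    · subst hj; exact hs
    · exact hc j (by omega) h2

theorem isChain_iff_right {ε : ℤ} {a b : ℕ} (h : a < b) :
    IsChain r m ε a (b + 1) ↔ IsStep r m ε (b - 1) ∧ IsChain r m ε a b := by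
  constructor
  · intro hc
    exact ⟨hc _ (by omega) (by omega), fun j h1 h2 => hc j h1 (by omega)⟩
  · rintro ⟨hs, hc⟩ j h1 h2
    by_cases hj : j = b - 1
    · subst hj; exact hs
    · exact hc j h1 (by omega)

theorem hasAscEdge_iff {a b : ℕ} :
    HasAscEdge r m a b ↔ a + 2 ≤ b ∧ IsChain r m 1 a b := by
  constructor
  · rintro ⟨c, d, p, q, hs, rfl, rfl, h1, h2⟩
    have := hs.2.1
    exact ⟨by omega, fun k hk1 hk2 => hs.isStep (by omega) (by omega)⟩
  · rintro ⟨h1, h2⟩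
    obtain ⟨c, d, hs, hc, hd⟩ := exists_isSegment (i := a) (j := b - 1) (by omega)
      fun k hk1 hk2 => h2 k hk1 (by omega)
    exact ⟨c, d, b - c, a - c, hs, by omega, by omega, by omega, by omega⟩

theorem hasDescEdge_iff {a b : ℕ} :
    HasDescEdge r m a b ↔ b + 2 ≤ a ∧ IsChain r m (-1) b a := by
  constructor
  · rintro ⟨c, d, p, q, hs, rfl, rfl, h1, h2⟩
    have := hs.2.1
    exact ⟨by omega, fun k hk1 hk2 => hs.isStep (by omega) (by omega)⟩
  · rintro ⟨h1, h2⟩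
    obtain ⟨c, d, hs, hc, hd⟩ := exists_isSegment (i := b) (j := a - 1) (by omega)
      fun k hk1 hk2 => h2 k hk1 (by omega)
    exact ⟨c, d, a - c, b - c, hs, by omega, by omega, by omega, by omega⟩

theorem edgeWeight_self (a : ℕ) :
    edgeWeight r R m a a = PowerSeries.X * PowerSeries.C (yOdd R m a) := by
  simp [edgeWeight, hasAscEdge_iff, hasDescEdge_iff]

theorem yDesc_succ_self (b : ℕ) : yDesc R m (b + 1) b = yEven R m b := by
  have : Finset.Ioo b (b + 1) = ∅ := by ext; simp
  simp [yDesc, this]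

theorem yDesc_succ {a b : ℕ} (h : b < a) :
    yDesc R m (a + 1) b = yEven R m a / yOdd R m a * yDesc R m a b := by
  have : Finset.Ioo b (a + 1) = insert a (Finset.Ioo b a) := by ext; simp; omega
  rw [yDesc, yDesc, Finset.prod_Ico_succ_top h.le, this, Finset.prod_insert (by simp), mul_comm,
    mul_div_mul_comm]

theorem edgeWeight_of_gt {a b : ℕ} (h : b < a) : edgeWeight r R m a b =
    PowerSeries.X * PowerSeries.C (if IsChain r m (-1) b a then yDesc R m a b else 0) := by
  have h1 : b ≠ a := by omega
  have h2 : b ≠ a + 1 := by omega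
  have h3 : ¬ a + 2 ≤ b := by omega
  by_cases hab : a = b + 1
  · subst hab
    have h4 : ¬ b + 2 ≤ b + 1 := by omega
    simp [edgeWeight, hasAscEdge_iff, hasDescEdge_iff, yDesc_succ_self, isChain_of_le, h2, h3]
  · have h4 : b + 2 ≤ a := by omega
    by_cases hc : IsChain r m (-1) b a <;>
      simp [edgeWeight, hasAscEdge_iff, hasDescEdge_iff, hab, h1, h2, h3, h4, hc]

theorem edgeWeight_of_lt {a b : ℕ} (h : a < b) : edgeWeight r R m a b =
    if IsChain r m 1 a b then (-1) ^ (b - a - 1) else 0 := by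
  have h1 : b ≠ a := by omega
  have h2 : a ≠ b + 1 := by omega
  have h3 : ¬ b + 2 ≤ a := by omega
  by_cases hab : b = a + 1
  · subst hab
    simp [edgeWeight, hasAscEdge_iff, hasDescEdge_iff, isChain_of_le, h2, h3]
  · have h4 : a + 2 ≤ b := by omega
    by_cases hc : IsChain r m 1 a b <;>
      simp [edgeWeight, hasAscEdge_iff, hasDescEdge_iff, hab, h1, h2, h3, h4, hc]

variable (K) in
/-- The entry of the inverse of `F` with labels `b, a`. -/
noncomputable def invFEntry (r : ℕ) (m : ℕ → ℤ) (b a : ℕ) : K :=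
  if a ≤ b ∧ IsChain r m 1 a b then (-1) ^ (b - a) else 0

variable (K) in
/-- The inverse of the matrix `F`. -/
noncomputable def invF (r : ℕ) (m : ℕ → ℤ) : Matrix (Fin (r + 1)) (Fin (r + 1)) K :=
  Matrix.of fun p q => invFEntry K r m (p + 1) (q + 1)

theorem strictLower_transfer :
    strictLower (transfer r R m) = 1 - const K (invF K r m) := by
  ext p q : 1
  rcases lt_trichotomy p q with h | rfl | h
  · simp [strictLower, const, invF, invFEntry, h.not_gt, h.ne, h.not_ge]
  · simp [strictLower, const, invF, invFEntry, isChain_of_le]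
  · have hpq : (q : ℕ) + 1 < p + 1 := by simpa using h
    simp only [strictLower, transfer, Matrix.of_apply, h, if_true, edgeWeight_of_lt hpq, const,
      invF, invFEntry, Matrix.sub_apply, Matrix.map_apply, Matrix.one_apply_ne h.ne', hpq.le,
      true_and]
    split_ifs
    · rw [map_pow, map_neg, map_one,
        show (p : ℕ) + 1 - (q + 1) = (p + 1 - (q + 1) - 1) + 1 by omega, pow_succ]
      simp
    · simp

theorem invFEntry_eq (b a : ℕ) : invFEntry K r m b a = (if b = a then 1 else 0) -
    if IsStep r m 1 a then invFEntry K r m b (a + 1) else if b = a + 1 then 1 else 0 := by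
  unfold invFEntry
  rcases lt_trichotomy b a with h | rfl | h
  · have a1 : ¬ a ≤ b := by omega
    have a2 : ¬ a + 1 ≤ b := by omega
    have a3 : b ≠ a + 1 := by omega
    simp [h.ne, a1, a2, a3]
  · simp [isChain_of_le]
  · rcases Nat.lt_or_ge (a + 1) b with h' | h'
    · simp only [isChain_iff_left h']
      by_cases hs : IsStep r m 1 a
      · simp only [h.le, h.ne', h'.le, hs, true_and, if_true, if_false, zero_sub]
        split_ifs
        · rw [show b - a = b - (a + 1) + 1 by omega, pow_succ]
          ring
        · simp
      · simp [hs, h.ne', h'.ne']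
    · obtain rfl : b = a + 1 := by omega
      simp [isChain_of_le]

theorem invF_mulVec_apply {i : ℕ} (h : i ≤ r) (p : Fin (r + 1)) :
    (invF K r m *ᵥ ev K r (i + 1)) p = invFEntry K r m (p + 1) (i + 1) :=
  mulVec_ev (invF K r m) p ⟨i, by omega⟩

theorem invF_mulVec_ev {i : ℕ} (h : i + 1 ≤ r) :
    invF K r m *ᵥ ev K r (i + 1) = ev K r (i + 1) -
      if IsStep r m 1 (i + 1) then invF K r m *ᵥ ev K r (i + 2) else ev K r (i + 2) := by
  ext p
  rw [Pi.sub_apply, apply_ite (fun v : Fin (r + 1) → K => v p), invF_mulVec_apply (by omega),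
    invF_mulVec_apply h, invFEntry_eq]
  rfl

/-- Going down from the last column, the recursions for `F` and `invF` make opposite choices at each
step, so the term labelled one higher always cancels. -/
theorem matF_mul_invF : matF K r m * invF K r m = 1 := by
  refine ext_ev fun j hj => ?_
  rw [Matrix.one_mulVec, ← Matrix.mulVec_mulVec]
  induction hj using Nat.decreasingInduction with
  | self =>
    have : invF K r m *ᵥ ev K r (r + 1) = ev K r (r + 1) := by
      ext p
      have hs : ¬ IsStep r m 1 (r + 1) := fun h => by
        have := h.2.1
        omega
      rw [invF_mulVec_apply le_rfl, invFEntry_eq, if_neg hs,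
        if_neg (show ¬ (p : ℕ) + 1 = r + 1 + 1 by omega), sub_zero]
      rfl
    rw [this, matF_mulVec_ev_top]
  | of_succ k hk ih =>
    rw [invF_mulVec_ev hk, Matrix.mulVec_sub, matF_mulVec_ev (by omega) hk]
    split_ifs
    · rw [ih, add_sub_cancel_right]
    · rw [add_sub_cancel_right]

/-- The entry of the matrix `D E` with labels `b, a`. -/
noncomputable def upperEntry (r : ℕ) (R : ℕ → ℤ → K) (m : ℕ → ℤ) (b a : ℕ) : K :=
  if b = a then yOdd R m a
  else if b < a ∧ IsChain r m (-1) b a then yDesc R m a b else 0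

/-- The matrix `D E`. -/
noncomputable def upperDE (r : ℕ) (R : ℕ → ℤ → K) (m : ℕ → ℤ) :
    Matrix (Fin (r + 1)) (Fin (r + 1)) K :=
  Matrix.of fun p q => upperEntry r R m (p + 1) (q + 1)

theorem upperPart_transfer :
    upperPart (transfer r R m) = (PowerSeries.X : K⟦X⟧) • const K (upperDE r R m) := by
  ext p q : 1
  rcases lt_trichotomy p q with h | rfl | h
  · have hpq : (p : ℕ) + 1 < q + 1 := by simpa using h
    simp only [upperPart, Matrix.of_apply, h.le, if_true, transfer, edgeWeight_of_gt hpq, const,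
      Matrix.smul_apply, Matrix.map_apply, upperDE, upperEntry, hpq.ne, if_false, hpq, true_and,
      smul_eq_mul]
  · simp [upperPart, transfer, edgeWeight_self, const, upperDE, upperEntry]
  · have h2 : ¬ (p : ℕ) = q := by rw [← Fin.ext_iff]; exact h.ne'
    simp [upperPart, const, upperDE, upperEntry, h.not_ge, h.not_gt, h2]

theorem upperEntry_succ {a : ℕ} (hy : yOdd R m a ≠ 0) (b : ℕ) :
    upperEntry r R m b (a + 1) = yOdd R m (a + 1) * (if b = a + 1 then 1 else 0) +
      yEven R m a / yOdd R m a * if IsStep r m (-1) (a - 1) then upperEntry r R m b a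
        else yOdd R m a * if b = a then 1 else 0 := by
  unfold upperEntry
  rcases lt_trichotomy b a with h | rfl | h
  · have h1 : b ≠ a + 1 := by omega
    have h2 : b < a + 1 := by omega
    simp only [isChain_iff_right h, yDesc_succ h]
    by_cases hs : IsStep r m (-1) (a - 1) <;> simp [h1, h2, h, h.ne, hs]
  · simp [isChain_of_le, yDesc_succ_self, hy]
  · by_cases h' : b = a + 1
    · subst h'
      simp
    · have h1 : ¬ b < a + 1 := by omega
      simp [h', h1, h.ne', h.not_gt]

theorem upperDE_mulVec_apply {i : ℕ} (h : i ≤ r) (p : Fin (r + 1)) :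
    (upperDE r R m *ᵥ ev K r (i + 1)) p = upperEntry r R m (p + 1) (i + 1) :=
  mulVec_ev (upperDE r R m) p ⟨i, by omega⟩

/-- Both sides satisfy the column recursion of `E`. Nonvanishing of the odd weights is needed to
cancel the denominators in its parameters. -/
theorem matD_mul_matE (hy : ∀ i, i ≤ r → yOdd R m (i + 1) ≠ 0) :
    matD r R m * matE r R m = upperDE r R m := by
  refine ext_ev fun j hj => ?_
  rw [← Matrix.mulVec_mulVec]
  induction j with
  | zero =>
    rw [zero_add, matE_mulVec_ev_one, matD_mulVec_ev le_rfl (by omega)]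
    ext p
    rw [show ev K r 1 = ev K r (0 + 1) from rfl, upperDE_mulVec_apply hj]
    simp [upperEntry, ev]
  | succ k ih =>
    rw [matE_mulVec_ev (by omega) hj, Matrix.mulVec_add, Matrix.mulVec_smul, apply_ite
      (fun v => matD r R m *ᵥ v), ih (by omega), matD_mulVec_ev (by omega) (by omega),
      matD_mulVec_ev (by omega) (by omega)]
    ext p
    rw [Pi.add_apply, Pi.smul_apply, Pi.smul_apply, apply_ite (fun v : Fin (r + 1) → K => v p),
      upperDE_mulVec_apply hj, upperDE_mulVec_apply (by omega),
      upperEntry_succ (hy k (by omega))]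
    rfl

end Columns

/-! ### Bruhat cells of products of elementary matrices -/

section Bruhat

variable {K : Type*} [Field K] {n r : ℕ}

theorem mul_mem_borelPlus {M N : Matrix (Fin n) (Fin n) K} (hM : M ∈ borelPlus K n)
    (hN : N ∈ borelPlus K n) : M * N ∈ borelPlus K n := by
  refine ⟨fun p q h => ?_, by rw [Matrix.det_mul]; exact hM.2.mul hN.2⟩
  have h1 : M.BlockTriangular id := fun i j h => hM.1 i j h
  have h2 : N.BlockTriangular id := fun i j h => hN.1 i j h
  exact h1.mul h2 h

theorem transpose_mem_borelMinus {M : Matrix (Fin n) (Fin n) K} (hM : M ∈ borelPlus K n) :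
    Mᵀ ∈ borelMinus K n :=
  ⟨fun p q h => hM.1 q p h, by rw [Matrix.det_transpose]; exact hM.2⟩

theorem transpose_mem_borelPlus {M : Matrix (Fin n) (Fin n) K} (hM : M ∈ borelMinus K n) :
    Mᵀ ∈ borelPlus K n :=
  ⟨fun p q h => hM.1 q p h, by rw [Matrix.det_transpose]; exact hM.2⟩

theorem mul_mem_borelMinus {M N : Matrix (Fin n) (Fin n) K} (hM : M ∈ borelMinus K n)
    (hN : N ∈ borelMinus K n) : M * N ∈ borelMinus K n := by
  have := transpose_mem_borelMinus
    (mul_mem_borelPlus (transpose_mem_borelPlus hN) (transpose_mem_borelPlus hM))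
  rwa [← Matrix.transpose_mul, Matrix.transpose_transpose] at this

theorem one_mem_borelPlus : (1 : Matrix (Fin n) (Fin n) K) ∈ borelPlus K n :=
  ⟨fun _ _ h => Matrix.one_apply_ne h.ne', by simp⟩

theorem diagonal_mem_borelPlus {d : Fin n → K} (h : ∀ i, d i ≠ 0) :
    Matrix.diagonal d ∈ borelPlus K n :=
  ⟨fun _ _ h => Matrix.diagonal_apply_ne _ h.ne', by
    rw [Matrix.det_diagonal, isUnit_iff_ne_zero]
    exact Finset.prod_ne_zero_iff.2 fun i _ => h i⟩

theorem transvection_mem_borelPlus {i j : Fin n} (h : i < j) (c : K) :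
    Matrix.transvection i j c ∈ borelPlus K n := by
  refine ⟨fun p q hpq => ?_, by rw [Matrix.det_transvection_of_ne i j h.ne]; exact isUnit_one⟩
  rw [Matrix.transvection, Matrix.add_apply, Matrix.one_apply_ne hpq.ne', zero_add,
    Matrix.single_apply_of_ne]
  rintro ⟨rfl, rfl⟩
  exact absurd h hpq.not_gt

theorem diag_ne_zero_of_mem_borelPlus {M : Matrix (Fin n) (Fin n) K} (hM : M ∈ borelPlus K n)
    (i : Fin n) : M i i ≠ 0 := by
  have h : M.BlockTriangular id := fun i j h => hM.1 i j h
  have hdet := hM.2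
  rw [Matrix.det_of_isUpperTriangular h, isUnit_iff_ne_zero, Finset.prod_ne_zero_iff] at hdet
  exact hdet i (Finset.mem_univ _)

theorem mul_permMat_apply (M : Matrix (Fin n) (Fin n) K) (w : Equiv.Perm (Fin n)) (p q : Fin n) :
    (M * permMat K w) p q = M p (w q) := by
  simp [Matrix.mul_apply, permMat]

theorem permMat_mul_apply (M : Matrix (Fin n) (Fin n) K) (w : Equiv.Perm (Fin n)) (p q : Fin n) :
    (permMat K w * M) p q = M (w⁻¹ p) q := by
  have : ∀ x, p = w x ↔ w⁻¹ p = x := fun x => by rw [Equiv.Perm.inv_eq_iff_eq]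
  simp [Matrix.mul_apply, permMat, this]

theorem permMat_mul (v w : Equiv.Perm (Fin n)) :
    permMat K (v * w) = permMat K v * permMat K w := by
  ext p q
  rw [mul_permMat_apply]
  rfl

theorem permMat_one : permMat K (1 : Equiv.Perm (Fin n)) = 1 := by
  ext p q
  rw [permMat, Matrix.of_apply, Matrix.one_apply]
  rfl

theorem transpose_permMat (w : Equiv.Perm (Fin n)) : (permMat K w)ᵀ = permMat K w⁻¹ := by
  ext p q
  simp only [permMat, Matrix.transpose_apply, Matrix.of_apply, Equiv.Perm.eq_inv_iff_eq]
  simp only [eq_comm]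

theorem isUnit_det_permMat (w : Equiv.Perm (Fin n)) : IsUnit (permMat K w).det := by
  apply Matrix.isUnit_det_of_right_inverse (B := permMat K w⁻¹)
  rw [← permMat_mul, mul_inv_cancel, permMat_one]

theorem permMat_mul_transvection (w : Equiv.Perm (Fin n)) (i j : Fin n) (c : K) :
    permMat K w * Matrix.transvection i j c = Matrix.transvection (w i) (w j) c * permMat K w := by
  ext p q
  rw [permMat_mul_apply, mul_permMat_apply]
  simp only [Matrix.transvection, Matrix.add_apply, Matrix.one_apply, Matrix.single_apply,
    Equiv.Perm.inv_eq_iff_eq, Equiv.Perm.eq_inv_iff_eq, EmbeddingLike.apply_eq_iff_eq]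

/-- Swapping adjacent indices `i < j` preserves the order of all other pairs. -/
theorem swap_lt_swap {i j p q : Fin n} (hij : (i : ℕ) + 1 = j) (h : q < p)
    (hne : ¬ (q = i ∧ p = j)) : Equiv.swap i j q < Equiv.swap i j p := by
  rw [Equiv.swap_apply_def, Equiv.swap_apply_def]
  simp only [Fin.ext_iff, Fin.lt_def] at *
  split_ifs <;> omega

/-- Conjugation by a simple reflection preserves the upper triangular matrices with vanishing
entry at the corresponding place. -/
theorem conj_mem_borelPlus {i j : Fin n} (hij : (i : ℕ) + 1 = j) {M : Matrix (Fin n) (Fin n) K}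
    (hM : M ∈ borelPlus K n) (h0 : M i j = 0) :
    permMat K (Equiv.swap i j) * M * permMat K (Equiv.swap i j) ∈ borelPlus K n := by
  refine ⟨fun p q h => ?_, ?_⟩
  · rw [mul_permMat_apply, permMat_mul_apply, Equiv.swap_inv]
    by_cases hne : q = i ∧ p = j
    · rw [hne.1, hne.2, Equiv.swap_apply_left, Equiv.swap_apply_right, h0]
    · exact hM.1 _ _ (swap_lt_swap hij h hne)
  · rw [Matrix.det_mul, Matrix.det_mul]
    exact ((isUnit_det_permMat _).mul hM.2).mul (isUnit_det_permMat _)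

theorem permMat_swap_mul_self (i j : Fin n) :
    permMat K (Equiv.swap i j) * permMat K (Equiv.swap i j) = 1 := by
  rw [← permMat_mul, Equiv.swap_mul_self, permMat_one]

/-- A lower elementary matrix lies in the Bruhat cell of its simple reflection. -/
theorem lower_transvection_eq {i j : Fin n} (hij : (i : ℕ) + 1 = j) {c : K} (hc : c ≠ 0) :
    ∃ b ∈ borelPlus K n, Matrix.transvection j i c =
      Matrix.transvection i j c⁻¹ * permMat K (Equiv.swap i j) * b := by
  have hlt : i < j := by rw [Fin.lt_def]; omega
  -- This is forced by solving for the upper factor. In the 2 × 2 block it has diagonal `c`, `-c⁻¹`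
  -- and upper entry `1`.
  refine ⟨permMat K (Equiv.swap i j) * (Matrix.transvection i j (-c⁻¹) *
    Matrix.transvection j i c), ⟨fun p q h => ?_, ?_⟩, ?_⟩
  · rw [permMat_mul_apply, Equiv.swap_inv]
    have e : Matrix.transvection i j (-c⁻¹) * Matrix.transvection j i c =
        1 + Matrix.single j i c + Matrix.single i j (-c⁻¹) + Matrix.single i i (-1) := by
      rw [Matrix.transvection, Matrix.transvection, add_mul, one_mul, mul_add, mul_one,
        Matrix.single_mul_single_same, neg_mul, inv_mul_cancel₀ hc, ← add_assoc]
    rw [e]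
    simp only [Matrix.add_apply, Matrix.one_apply, Matrix.single_apply, Equiv.swap_apply_def]
    have hji : j ≠ i := hlt.ne'
    by_cases hp : p = i
    · subst hp
      have h1 : j ≠ q := fun h' => by subst h'; exact absurd h hlt.not_gt
      simp [h1, hlt.ne, h.ne']
    · by_cases hp' : p = j
      · subst hp'
        have h1 : p ≠ q := h.ne'
        by_cases hq : i = q
        · subst hq
          simp [hji]
        · simp [hji, hq, h1]
      · have h1 : i ≠ p := fun h' => hp h'.symm
        have h2 : j ≠ p := fun h' => hp' h'.symm
        simp [hp, hp', h1, h2, h.ne']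
  · rw [Matrix.det_mul, Matrix.det_mul, Matrix.det_transvection_of_ne _ _ hlt.ne,
      Matrix.det_transvection_of_ne _ _ hlt.ne', one_mul, mul_one]
    exact isUnit_det_permMat _
  · rw [mul_assoc, ← mul_assoc (permMat K _), permMat_swap_mul_self, one_mul, ← mul_assoc,
      Matrix.transvection_mul_transvection_same _ _ hlt.ne, add_neg_cancel,
      Matrix.transvection_zero, one_mul]

/-- Multiplying the Bruhat cell of `w` by a lower elementary matrix, in the length-increasing
case. -/
theorem bruhat_mul_transvection {i j : Fin n} (hij : (i : ℕ) + 1 = j) {c : K} (hc : c ≠ 0)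
    {w : Equiv.Perm (Fin n)} (hw : w i < w j) {g : Matrix (Fin n) (Fin n) K}
    (hg : ∃ b ∈ borelPlus K n, ∃ b' ∈ borelPlus K n, g = b * permMat K w * b') :
    ∃ b ∈ borelPlus K n, ∃ b' ∈ borelPlus K n,
      g * Matrix.transvection j i c = b * permMat K (w * Equiv.swap i j) * b' := by
  have hlt : i < j := by rw [Fin.lt_def]; omega
  obtain ⟨b, hb, b', hb', rfl⟩ := hg
  obtain ⟨b₀, hb₀, hf⟩ := lower_transvection_eq hij hc
  obtain ⟨b₂, e₂⟩ : ∃ b₂, b' * Matrix.transvection i j c⁻¹ = b₂ := ⟨_, rfl⟩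
  have hb₂ : b₂ ∈ borelPlus K n := e₂ ▸ mul_mem_borelPlus hb' (transvection_mem_borelPlus hlt _)
  -- `t` is chosen so that splitting off a transvection on the left kills the entry at `(i, j)`. The
  -- transvection passes through `w` and stays upper because `w i < w j`; the remainder survives
  -- conjugation by the swap.
  obtain ⟨t, ht⟩ : ∃ t, t = b₂ i j / b₂ j j := ⟨_, rfl⟩
  obtain ⟨b₃, e₃⟩ : ∃ b₃, Matrix.transvection i j (-t) * b₂ = b₃ := ⟨_, rfl⟩
  have hb₃ : b₃ ∈ borelPlus K n := e₃ ▸ mul_mem_borelPlus (transvection_mem_borelPlus hlt _) hb₂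
  have h₃ : b₃ i j = 0 := by
    rw [← e₃, Matrix.transvection_mul_apply_same, ht, neg_mul,
      div_mul_cancel₀ _ (diag_ne_zero_of_mem_borelPlus hb₂ j), add_neg_cancel]
  have e₂₃ : b₂ = Matrix.transvection i j t * b₃ := by
    rw [← e₃, ← mul_assoc, Matrix.transvection_mul_transvection_same _ _ hlt.ne, add_neg_cancel,
      Matrix.transvection_zero, one_mul]
  refine ⟨b * Matrix.transvection (w i) (w j) t,
    mul_mem_borelPlus hb (transvection_mem_borelPlus hw _),
    permMat K (Equiv.swap i j) * b₃ * permMat K (Equiv.swap i j) * b₀,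
    mul_mem_borelPlus (conj_mem_borelPlus hij hb₃ h₃) hb₀, ?_⟩
  calc b * permMat K w * b' * Matrix.transvection j i c
      = b * permMat K w * (b' * Matrix.transvection i j c⁻¹) * permMat K (Equiv.swap i j) * b₀ := by
        rw [hf]; simp only [mul_assoc]
    _ = b * (permMat K w * Matrix.transvection i j t) * b₃ * permMat K (Equiv.swap i j) * b₀ := by
        rw [e₂, e₂₃]; simp only [mul_assoc]
    _ = b * Matrix.transvection (w i) (w j) t * permMat K w *
        (permMat K (Equiv.swap i j) * permMat K (Equiv.swap i j)) * b₃ *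
          permMat K (Equiv.swap i j) * b₀ := by
        rw [permMat_mul_transvection, permMat_swap_mul_self]; simp only [mul_assoc, one_mul]
    _ = _ := by
        rw [permMat_mul]; simp only [mul_assoc]

theorem elemF_eq_transvection (c : K) {i : ℕ} (h : i < r) :
    elemF r c (i + 1) = Matrix.transvection (⟨i + 1, by omega⟩ : Fin (r + 1)) ⟨i, by omega⟩ c := by
  rw [elemF, Matrix.transvection]
  congr 1
  ext p q
  simp only [unitMatrix, Matrix.smul_apply, Matrix.of_apply, Matrix.single_apply, Fin.ext_iff,
    add_left_inj, smul_eq_mul, mul_ite, mul_one, mul_zero]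
  simp only [eq_comm]

theorem transpose_elemE (c : K) (i : ℕ) : (elemE r c i)ᵀ = elemF r c i := by
  rw [elemE, elemF, Matrix.transpose_add, Matrix.transpose_one, Matrix.transpose_smul]
  congr 2
  ext p q
  simp only [unitMatrix, Matrix.transpose_apply, Matrix.of_apply, and_comm]

theorem simpleRefl_eq_swap {i : ℕ} (h : i < r) :
    simpleRefl r (i + 1) = Equiv.swap (⟨i, by omega⟩ : Fin (r + 1)) ⟨i + 1, by omega⟩ := by
  rw [simpleRefl]
  congr 1
  · ext
    simp only [Fin.ofNat, Nat.add_sub_cancel]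
    exact Nat.mod_eq_of_lt (by omega)
  · ext
    simp only [Fin.ofNat]
    exact Nat.mod_eq_of_lt (by omega)

/-- Without the reflection `s_i`, the labels up to `i` are preserved. -/
theorem reflProd_lt_iff {l : List ℕ} (hl : ∀ j ∈ l, 1 ≤ j ∧ j ≤ r) {i : ℕ} (hi : i ∉ l)
    (x : Fin (r + 1)) : (reflProd r l x : ℕ) < i ↔ (x : ℕ) < i := by
  induction l with
  | nil => simp [reflProd]
  | cons j l ih =>
    rw [← ih (fun k hk => hl k (List.mem_cons_of_mem _ hk)) fun h => hi (List.mem_cons_of_mem _ h)]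
    obtain ⟨h1, h2⟩ := hl j List.mem_cons_self
    obtain ⟨j, rfl⟩ : ∃ j', j = j' + 1 := ⟨j - 1, by omega⟩
    have hne : i ≠ j + 1 := fun h => hi (h ▸ List.mem_cons_self)
    rw [reflProd, List.map_cons, List.prod_cons, Equiv.Perm.mul_apply, simpleRefl_eq_swap h2,
      ← reflProd, Equiv.swap_apply_def]
    simp only [Fin.ext_iff]
    split_ifs <;> simp only <;> omega

/-- Without `s_i`, the product of the earlier reflections cannot carry a label across the cut
between `i` and `i + 1`. It therefore keeps these two labels in order, so appending `s_i` is
length-increasing. -/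
theorem prodF_mem_bruhat {c : ℕ → K} {l : List ℕ} (hl : ∀ j ∈ l, 1 ≤ j ∧ j ≤ r)
    (hc : ∀ j ∈ l, c j ≠ 0) (hn : l.Nodup) :
    ∃ b ∈ borelPlus K (r + 1), ∃ b' ∈ borelPlus K (r + 1),
      (l.map fun i => elemF r (c i) i).prod = b * permMat K (reflProd r l) * b' := by
  induction l using List.reverseRecOn with
  | nil => exact ⟨1, one_mem_borelPlus, 1, one_mem_borelPlus, by simp [reflProd, permMat_one]⟩
  | append_singleton l i ih =>
    have hi : i ∉ l := by
      rw [List.nodup_append] at hn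
      exact fun h => hn.2.2 i h i (List.mem_singleton_self i) rfl
    obtain ⟨h1, h2⟩ := hl i (by simp)
    have hci := hc i (by simp)
    have hl' : ∀ j ∈ l, 1 ≤ j ∧ j ≤ r := fun j hj => hl j (List.mem_append_left _ hj)
    have ih := ih hl' (fun j hj => hc j (List.mem_append_left _ hj)) (hn.of_append_left)
    obtain ⟨i, rfl⟩ : ∃ i', i = i' + 1 := ⟨i - 1, by omega⟩
    have hw : reflProd r l ⟨i, by omega⟩ < reflProd r l ⟨i + 1, by omega⟩ := by
      have e1 := (reflProd_lt_iff hl' hi ⟨i, by omega⟩).2 (by simp)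
      have e2 := mt (reflProd_lt_iff hl' hi ⟨i + 1, by omega⟩).1 (by simp)
      rw [Fin.lt_def]
      omega
    have := bruhat_mul_transvection (i := ⟨i, by omega⟩) (j := ⟨i + 1, by omega⟩) rfl hci hw ih
    rw [← elemF_eq_transvection _ h2, ← simpleRefl_eq_swap h2] at this
    simpa [reflProd] using this

theorem reflProd_reverse (l : List ℕ) : reflProd r l.reverse = (reflProd r l)⁻¹ := by
  induction l with
  | nil => simp [reflProd]
  | cons i l ih =>
    rw [reflProd] at ih ⊢
    rw [List.reverse_cons, List.map_append, List.prod_append, ih]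
    simp [reflProd, simpleRefl]

/-- Transposition exchanges the two Borel subgroups, turns each `e_i` into `f_i`, and inverts the
permutation; it also reverses the product, which compensates the inversion. -/
theorem prodE_mem_bruhat {c : ℕ → K} {l : List ℕ} (hl : ∀ j ∈ l, 1 ≤ j ∧ j ≤ r)
    (hc : ∀ j ∈ l, c j ≠ 0) (hn : l.Nodup) :
    ∃ b ∈ borelMinus K (r + 1), ∃ b' ∈ borelMinus K (r + 1),
      (l.map fun i => elemE r (c i) i).prod = b * permMat K (reflProd r l) * b' := by
  obtain ⟨b, hb, b', hb', h⟩ := prodF_mem_bruhat (l := l.reverse) (c := c)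
    (fun j hj => hl j (List.mem_reverse.1 hj)) (fun j hj => hc j (List.mem_reverse.1 hj))
    (List.nodup_reverse.2 hn)
  refine ⟨b'ᵀ, transpose_mem_borelMinus hb', bᵀ, transpose_mem_borelMinus hb, ?_⟩
  have e : (l.map fun i => elemE r (c i) i).prod =
      ((l.reverse.map fun i => elemF r (c i) i).prod)ᵀ := by
    rw [Matrix.transpose_list_prod, List.map_map, ← List.map_reverse, List.reverse_reverse]
    congr 1
    refine List.map_congr_left fun i _ => ?_
    rw [Function.comp_apply, ← transpose_elemE, Matrix.transpose_transpose]
  rw [e, h, Matrix.transpose_mul, Matrix.transpose_mul, transpose_permMat, reflProd_reverse,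
    inv_inv, mul_assoc]

theorem prodF_mem_borelMinus (c : ℕ → K) {l : List ℕ} (hl : ∀ j ∈ l, 1 ≤ j ∧ j ≤ r) :
    (l.map fun i => elemF r (c i) i).prod ∈ borelMinus K (r + 1) := by
  induction l with
  | nil =>
    have := transpose_mem_borelMinus (one_mem_borelPlus (K := K) (n := r + 1))
    simpa using this
  | cons i l ih =>
    obtain ⟨h1, h2⟩ := hl i List.mem_cons_self
    obtain ⟨i, rfl⟩ : ∃ i', i = i' + 1 := ⟨i - 1, by omega⟩
    rw [List.map_cons, List.prod_cons]
    refine mul_mem_borelMinus ?_ (ih fun j hj => hl j (List.mem_cons_of_mem _ hj))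
    have := transpose_mem_borelMinus (transvection_mem_borelPlus
      (i := (⟨i, by omega⟩ : Fin (r + 1))) (j := ⟨i + 1, by omega⟩) (by simp [Fin.lt_def])
      (c (i + 1)))
    rw [elemF_eq_transvection _ h2]
    simpa [Matrix.transvection, Matrix.transpose_add] using this

theorem prodE_mem_borelPlus (c : ℕ → K) {l : List ℕ} (hl : ∀ j ∈ l, 1 ≤ j ∧ j ≤ r) :
    (l.map fun i => elemE r (c i) i).prod ∈ borelPlus K (r + 1) := by
  have := transpose_mem_borelPlus (prodF_mem_borelMinus c (l := l.reverse)
    fun j hj => hl j (List.mem_reverse.1 hj))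
  rw [Matrix.transpose_list_prod, List.map_map, ← List.map_reverse, List.reverse_reverse] at this
  convert this using 4 with i
  rw [Function.comp_apply, ← transpose_elemE, Matrix.transpose_transpose]

end Bruhat

/-! ### The double Bruhat cell of `P_m` -/

section MatP

variable {K : Type*} [Field K] {r : ℕ} {R : ℕ → ℤ → K} {m : ℕ → ℤ}

theorem matD_eq_diagonal : matD r R m = Matrix.diagonal fun p : Fin (r + 1) => yOdd R m (p + 1) := by
  refine ext_ev fun j hj => ?_
  rw [matD_mulVec_ev (by omega) (by omega)]
  ext p
  rw [Matrix.mulVec_diagonal, Pi.smul_apply, smul_eq_mul]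
  simp only [ev]
  split_ifs with h
  · rw [h]
  · simp

theorem isCoxeterElement_reorder (ε : ℤ) :
    IsCoxeterElement r (reflProd r (reorder r m ε)) :=
  ⟨_, reorder_perm, rfl⟩

theorem matP_mem_doubleBruhatCell (hy : ∀ i, i ≤ r → yOdd R m (i + 1) ≠ 0)
    (hy' : ∀ i, 1 ≤ i → i ≤ r → yEven R m i ≠ 0) :
    matP r R m ∈ doubleBruhatCell K (reflProd r (sigmaSeq r m)) (reflProd r (tauSeq r m)) := by
  have hl : ∀ ε, ∀ j ∈ reorder r m ε, 1 ≤ j ∧ j ≤ r := fun ε j hj => mem_reorder.1 hj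
  have hD : ∀ p : Fin (r + 1), yOdd R m (p + 1) ≠ 0 := fun p => hy p (by omega)
  constructor
  · obtain ⟨b, hb, b', hb', h⟩ := prodF_mem_bruhat (c := fun _ => (1 : K)) (hl 1)
      (fun _ _ => one_ne_zero) nodup_reorder
    refine ⟨b, hb, b' * (matD r R m * matE r R m), mul_mem_borelPlus hb' (mul_mem_borelPlus ?_
      (prodE_mem_borelPlus (fun i => yEven R m i / yOdd R m i) (hl (-1)))), ?_⟩
    · rw [matD_eq_diagonal]
      exact diagonal_mem_borelPlus hD
    · rw [matP, show matF K r m = _ from h]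
      simp only [mul_assoc]
      rfl
  · obtain ⟨b, hb, b', hb', h⟩ := prodE_mem_bruhat
      (c := fun i => yEven R m i / yOdd R m i) (hl (-1)) (fun j hj => by
        obtain ⟨h1, h2⟩ := hl (-1) j hj
        refine div_ne_zero (hy' j h1 h2) ?_
        have := hy (j - 1) (by omega)
        rwa [Nat.sub_add_cancel h1] at this) nodup_reorder
    refine ⟨matF K r m * matD r R m * b, mul_mem_borelMinus (mul_mem_borelMinus
      (prodF_mem_borelMinus (fun _ => (1 : K)) (hl 1)) ?_) hb, b', hb', ?_⟩
    · have := transpose_mem_borelMinus (diagonal_mem_borelPlus hD)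
      rwa [Matrix.diagonal_transpose, ← matD_eq_diagonal] at this
    · rw [matP, show matE r R m = _ from h]
      simp only [mul_assoc]
      rfl

end MatP

/-! ### The time shift and the moments of `P_m` -/

section Moments

variable {K : Type*} [Field K] {r : ℕ} {R : ℕ → ℤ → K} {m : ℕ → ℤ}

/-- The extension of the path by horizontal steps at both ends. -/
def extend (r : ℕ) (m : ℕ → ℤ) (i : ℕ) : ℤ :=
  if i = 0 then m 1 else if i = r + 1 then m r else m i

theorem extend_of_mem {i : ℕ} (h1 : 1 ≤ i) (h2 : i ≤ r) : extend r m i = m i := by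
  rw [extend, if_neg (by omega), if_neg (by omega)]

theorem lam_zero (hR : IsSolution r R) (n : ℤ) : lam R 0 n = 1 := by simp [lam, hR.bot]

theorem lam_top (hR : IsSolution r R) (n : ℤ) : lam R (r + 1) n = 1 := by simp [lam, hR.top]

theorem lam_extend (hR : IsSolution r R) {i : ℕ} (h : i ≤ r + 1) :
    lam R i (extend r m i) = lam R i (m i) := by
  rcases Nat.eq_zero_or_pos i with rfl | h0
  · rw [lam_zero hR, lam_zero hR]
  · rcases Nat.lt_or_ge r i with h1 | h1
    · obtain rfl : i = r + 1 := by omega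
      rw [lam_top hR, lam_top hR]
    · rw [extend_of_mem h0 h1]

theorem yOdd_extend (hR : IsSolution r R) {i : ℕ} (h : i ≤ r + 1) :
    yOdd R (extend r m) i = yOdd R m i := by
  rw [yOdd, yOdd, lam_extend hR h, lam_extend hR (by omega)]

theorem yEven_extend (hR : IsSolution r R) {i : ℕ} (h0 : 1 ≤ i) (h : i ≤ r) :
    yEven R (extend r m) i = yEven R m i := by
  rw [yEven, yEven, lam_extend hR (by omega), lam_extend hR (by omega), extend_of_mem h0 h]
  -- At the two ends, the conditions may differ between the two paths, but the correction factors
  -- equal `1` in either branch.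
  refine congrArg₂ _ (congrArg₂ _ rfl ?_) ?_
  · rcases h.lt_or_eq with h1 | rfl
    · rw [extend_of_mem (by omega) (by omega)]
    · simp [lam_top hR]
  · rcases h0.lt_or_eq with h1 | rfl
    · rw [extend_of_mem (by omega) (by omega)]
    · simp only [Nat.sub_self, lam_zero hR, div_one, ite_self]

/-- The added horizontal step makes the bare comparison of heights false at `i = r`, as `IsStep`
demands. The wave identities can therefore be used without boundary cases. -/
theorem isStep_iff_extend {i : ℕ} (h0 : 1 ≤ i) (h : i ≤ r) :
    IsStep r m 1 i ↔ extend r m (i + 1) = extend r m i + 1 := by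
  rw [extend_of_mem h0 h, IsStep]
  rcases h.lt_or_eq with h1 | rfl
  · rw [extend_of_mem (by omega) (by omega)]
    tauto
  · rw [extend, if_neg (by omega), if_pos rfl]
    omega

theorem isStep_neg_iff_extend {i : ℕ} (h : i + 1 ≤ r) :
    IsStep r m (-1) i ↔ extend r m i = extend r m (i + 1) + 1 := by
  rw [extend_of_mem (by omega) h, IsStep]
  rcases Nat.eq_zero_or_pos i with rfl | h1
  · rw [extend, if_pos rfl, zero_add]
    omega
  · rw [extend_of_mem h1 (by omega)]
    omega

theorem extend_step (hm : IsMotzkinPath r m) {i : ℕ} (h : i ≤ r) :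
    |extend r m i - extend r m (i + 1)| ≤ 1 := by
  obtain ⟨α, h1, h2, -⟩ := hm.exists_zero
  rcases Nat.eq_zero_or_pos i with rfl | h0
  · rw [extend, if_pos rfl, extend_of_mem (by omega) (by omega)]
    simp
  · rw [extend_of_mem h0 h]
    rcases h.lt_or_eq with h1 | rfl
    · rw [extend_of_mem (by omega) (by omega)]
      exact hm.step i h0 h1
    · rw [extend, if_neg (by omega), if_pos rfl]
      simp

theorem lam_ne_zero (hR : IsSolution r R) {i : ℕ} (h : i ≤ r + 1) (n : ℤ) : lam R i n ≠ 0 :=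
  div_ne_zero (hR.ne_zero' h _) (hR.ne_zero' h _)

theorem yOdd_ne_zero (hR : IsSolution r R) {i : ℕ} (h : i ≤ r + 1) : yOdd R m i ≠ 0 :=
  div_ne_zero (lam_ne_zero hR h _) (lam_ne_zero hR (by omega) _)

theorem yEven_ne_zero (hR : IsSolution r R) {i : ℕ} (h : i ≤ r) : yEven R m i ≠ 0 := by
  have hmu : ∀ j ≤ r + 1, ∀ n, mu R j n ≠ 0 := fun j hj n =>
    div_ne_zero (hR.ne_zero' hj _) (hR.ne_zero' (by omega) _)
  have hlam := fun j hj n => lam_ne_zero hR (i := j) hj n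
  unfold yEven
  refine mul_ne_zero (mul_ne_zero (div_ne_zero (hmu _ (by omega) _) (hmu _ (by omega) _)) ?_) ?_
  · split_ifs
    · exact div_ne_zero (hlam _ (by omega) _) (hlam _ (by omega) _)
    · exact one_ne_zero
  · split_ifs
    · exact div_ne_zero (hlam _ (by omega) _) (hlam _ (by omega) _)
    · exact one_ne_zero

/-- The values at `n` of the basis sequences. -/
def waveVec (r : ℕ) (R : ℕ → ℤ → K) (m : ℕ → ℤ) (n : ℤ) : Fin (r + 1) → K :=
  fun p => wave R (extend r m) (p + 1) n

theorem waveVec_dotProduct_ev {j : ℕ} (h : j ≤ r) (n : ℤ) :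
    waveVec r R m n ⬝ᵥ ev K r (j + 1) = wave R (extend r m) (j + 1) n := by
  rw [dotProduct_ev h, waveVec]

theorem waveVec_matF (hm : IsMotzkinPath r m) (hR : IsSolution r R) {j : ℕ} (h : j ≤ r) (n : ℤ) :
    waveVec r R m n ⬝ᵥ (matF K r m *ᵥ ev K r (j + 1)) = wave' R (extend r m) (j + 1) n := by
  induction h using Nat.decreasingInduction with
  | self => rw [matF_mulVec_ev_top, waveVec_dotProduct_ev le_rfl, wave'_top hR]
  | of_succ k hk ih =>
    rw [matF_mulVec_ev (by omega) hk, dotProduct_add, apply_ite (fun v => waveVec r R m n ⬝ᵥ v),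
      waveVec_dotProduct_ev (by omega), waveVec_dotProduct_ev hk, ih,
      wave'_eq hR (fun i hi => extend_step hm (i := i) hi) hk]
    simp only [isStep_iff_extend (m := m) (show 1 ≤ k + 1 by omega) hk]

theorem waveVec_matP (hm : IsMotzkinPath r m) (hR : IsSolution r R) {j : ℕ} (h : j ≤ r) (n : ℤ) :
    waveVec r R m n ⬝ᵥ (matP r R m *ᵥ ev K r (j + 1)) = wave R (extend r m) (j + 1) (n + 1) := by
  rw [matP, ← Matrix.mulVec_mulVec]
  induction j with
  | zero =>
    rw [zero_add, matE_mulVec_ev_one, ← Matrix.mulVec_mulVec, matD_mulVec_ev le_rfl (by omega),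
      Matrix.mulVec_smul, dotProduct_smul, wave_one_succ hR, yOdd_extend hR (by omega)]
    rw [show ev K r 1 = ev K r (0 + 1) from rfl, waveVec_matF hm hR h]
    rfl
  | succ k ih =>
    have hFD : ∀ {j}, j ≤ r → waveVec r R m n ⬝ᵥ (matF K r m * matD r R m) *ᵥ ev K r (j + 1) =
        yOdd R m (j + 1) * wave' R (extend r m) (j + 1) n := by
      intro j hj
      rw [← Matrix.mulVec_mulVec, matD_mulVec_ev (by omega) (by omega), Matrix.mulVec_smul,
        dotProduct_smul, waveVec_matF hm hR hj, smul_eq_mul]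
    rw [matE_mulVec_ev (by omega) h, Matrix.mulVec_add, Matrix.mulVec_smul, dotProduct_add,
      dotProduct_smul, hFD h, Nat.add_sub_cancel,
      wave_succ hR (fun i hi => extend_step hm (i := i) hi) h, yOdd_extend hR (by omega),
      yOdd_extend hR (by omega), yEven_extend hR (by omega) h]
    simp only [← isStep_neg_iff_extend (m := m) h]
    split_ifs
    · rw [ih (by omega), smul_eq_mul]
    · rw [hFD (by omega), smul_eq_mul, ← mul_assoc,
        div_mul_cancel₀ _ (yOdd_ne_zero hR (by omega))]

theorem waveVec_vecMul_matP (hm : IsMotzkinPath r m) (hR : IsSolution r R) (n : ℤ) :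
    waveVec r R m n ᵥ* matP r R m = waveVec r R m (n + 1) := by
  ext q
  have h := waveVec_matP hm hR (j := q) (by omega) n
  rw [Matrix.dotProduct_mulVec, dotProduct_ev (by omega)] at h
  exact h

theorem waveVec_zero (hm : IsMotzkinPath r m) (hR : IsSolution r R) :
    waveVec r R m 0 = Pi.single 0 1 := by
  ext p
  rw [waveVec]
  rcases Nat.eq_zero_or_pos p with h | h
  · obtain rfl : p = 0 := Fin.ext h
    rw [Pi.single_eq_same]
    change wave R (extend r m) 1 0 = 1
    rw [wave_one, zero_add, div_self (hR.ne_zero' (by omega) _)]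
  · rw [wave_zero hR h (by omega) fun i hi => extend_step hm (i := i) hi,
      Pi.single_eq_of_ne (by rintro rfl; simp at h)]

/-- The moments of `P_m` are given by the solution of the `Q`-system. -/
theorem matP_pow_mul_matF (hm : IsMotzkinPath r m) (hR : IsSolution r R) (n : ℕ) :
    R 1 (n + m 1 + 1) = R 1 (m 1 + 1) * (matP r R m ^ n * matF K r m) 0 0 := by
  have hr : 1 ≤ r := by
    obtain ⟨α, h1, h2, -⟩ := hm.exists_zero
    omega
  -- The first row of the `n`-th power is the wave vector at time `n`, because the wave vector at
  -- time `0` is the first basis row.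
  have hpow : ∀ n : ℕ, (Pi.single 0 1 : Fin (r + 1) → K) ᵥ* matP r R m ^ n =
      waveVec r R m n := by
    intro n
    induction n with
    | zero => rw [pow_zero, Matrix.vecMul_one, Nat.cast_zero, waveVec_zero hm hR]
    | succ n ih =>
      rw [pow_succ, ← Matrix.vecMul_vecMul, ih, waveVec_vecMul_matP hm hR, Nat.cast_succ]
  have h := waveVec_matF hm hR (j := 0) (by omega) n
  rw [zero_add, wave'_one, extend_of_mem le_rfl hr, ← hpow, Matrix.dotProduct_mulVec,
    Matrix.vecMul_vecMul, show ev K r 1 = ev K r (0 + 1) from rfl, dotProduct_ev (by omega),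
    Matrix.single_one_vecMul] at h
  rw [eq_div_iff (hR.ne_zero' (by omega) _)] at h
  rw [← h, mul_comm]
  rfl

end Moments

/-! ### Resolvents and the first row sums -/

section Resolvent

variable {K : Type*} [Field K] {r : ℕ} {R : ℕ → ℤ → K} {m : ℕ → ℤ}

theorem const_mul {n : ℕ} (M N : Matrix (Fin n) (Fin n) K) :
    const K (M * N) = const K M * const K N := Matrix.map_mul

theorem const_one {n : ℕ} : const K (1 : Matrix (Fin n) (Fin n) K) = 1 :=
  Matrix.map_one _ (map_zero _) (map_one _)

/-- The generating series of the powers of a matrix. -/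
noncomputable def powerMatrix {n : ℕ} (M : Matrix (Fin n) (Fin n) K) :
    Matrix (Fin n) (Fin n) K⟦X⟧ :=
  Matrix.of fun p q => PowerSeries.mk fun k => (M ^ k) p q

theorem one_sub_mul_powerMatrix {n : ℕ} (M : Matrix (Fin n) (Fin n) K) :
    (1 - (PowerSeries.X : K⟦X⟧) • const K M) * powerMatrix M = 1 := by
  ext p q k
  rw [sub_mul, one_mul, Matrix.smul_mul, Matrix.sub_apply, Matrix.smul_apply, smul_eq_mul,
    map_sub, Matrix.mul_apply]
  cases k with
  | zero =>
    simp [powerMatrix, Matrix.one_apply, apply_ite]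
  | succ k =>
    rw [mul_comm, PowerSeries.coeff_succ_mul_X, map_sum]
    simp only [const, powerMatrix, Matrix.of_apply, Matrix.map_apply, PowerSeries.coeff_C_mul,
      PowerSeries.coeff_mk]
    rw [pow_succ', Matrix.mul_apply, sub_self, Matrix.one_apply]
    split_ifs <;> simp [PowerSeries.coeff_one]

theorem isUnit_det_one_sub {n : ℕ} (M : Matrix (Fin n) (Fin n) K) :
    IsUnit (1 - (PowerSeries.X : K⟦X⟧) • const K M).det :=
  Matrix.isUnit_det_of_right_inverse (one_sub_mul_powerMatrix M)

theorem resolventP_eq : resolventP r R m = powerMatrix (matP r R m) :=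
  Matrix.inv_eq_right_inv (one_sub_mul_powerMatrix _)

theorem matF_inv : (matF K r m)⁻¹ = invF K r m := Matrix.inv_eq_right_inv matF_mul_invF

theorem invF_mul_matF : invF K r m * matF K r m = 1 :=
  mul_eq_one_comm.1 matF_mul_invF

theorem transfer_eq_add :
    transfer r R m = strictLower (transfer r R m) + upperPart (transfer r R m) := by
  ext p q : 1
  rcases le_or_gt p q with h | h
  · simp [strictLower, upperPart, h, h.not_gt]
  · simp [strictLower, upperPart, h, h.not_ge]

theorem upperPart_transfer_eq (hR : IsSolution r R) : upperPart (transfer r R m) =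
    (PowerSeries.X : K⟦X⟧) • const K (matD r R m * matE r R m) := by
  rw [upperPart_transfer, matD_mul_matE fun i hi => yOdd_ne_zero hR (by omega)]

theorem one_sub_transfer (hR : IsSolution r R) : 1 - transfer r R m =
    const K (invF K r m) * (1 - (PowerSeries.X : K⟦X⟧) • const K (matP r R m)) := by
  rw [transfer_eq_add, strictLower_transfer, upperPart_transfer_eq hR, mul_sub, mul_one,
    Matrix.mul_smul, ← const_mul, matP, mul_assoc, ← mul_assoc (invF K r m), invF_mul_matF, one_mul]
  abel

theorem one_sub_transfer_mul (hR : IsSolution r R) :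
    (1 - transfer r R m) * (resolventP r R m * const K (matF K r m)) = 1 := by
  rw [one_sub_transfer hR, resolventP_eq, mul_assoc, ← mul_assoc (1 - _),
    one_sub_mul_powerMatrix, one_mul, ← const_mul, invF_mul_matF, const_one]

theorem transfer_resolvent (hR : IsSolution r R) :
    (1 - transfer r R m)⁻¹ = resolventP r R m * const K (matF K r m) :=
  Matrix.inv_eq_right_inv (one_sub_transfer_mul hR)

theorem coeff_transfer_resolvent (hR : IsSolution r R) (n : ℕ) (p q : Fin (r + 1)) :
    PowerSeries.coeff n ((1 - transfer r R m)⁻¹ p q) = (matP r R m ^ n * matF K r m) p q := by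
  rw [transfer_resolvent hR, resolventP_eq, Matrix.mul_apply, Matrix.mul_apply, map_sum]
  simp [powerMatrix, const, PowerSeries.coeff_mul_C]

/-- The first column of `F`, up to the first ascending step. -/
theorem matF_first_column {a : ℕ} (h : ∀ i, 1 ≤ i → i < a → ¬ IsStep r m 1 i)
    (ha : a ≤ r + 1) (ha' : 1 ≤ a) : matF K r m *ᵥ ev K r 1 =
      (∑ i ∈ Finset.Ico 1 a, ev K r i) + matF K r m *ᵥ ev K r a := by
  induction a, ha' using Nat.le_induction with
  | base => simp
  | succ a ha' ih =>
    rw [ih (fun i h1 h2 => h i h1 (by omega)) (by omega), matF_mulVec_ev ha' (by omega),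
      if_neg (h a ha' (by omega)), Finset.sum_Ico_succ_top ha', add_assoc]

theorem sum_ev_apply (a : ℕ) (p : Fin (r + 1)) :
    (∑ i ∈ Finset.Ico 1 a, ev K r i) p = if (p : ℕ) + 1 < a then 1 else 0 := by
  simp [Finset.sum_apply, ev, Finset.sum_ite_eq]

/-- The first column of `F` consists of ones above zeros, so multiplying the first row of the
resolvent by it gives a partial row sum. -/
theorem transfer_resolvent_of_first_column (hR : IsSolution r R) {a : ℕ}
    (h : matF K r m *ᵥ ev K r 1 = ∑ i ∈ Finset.Ico 1 a, ev K r i) :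
    (1 - transfer r R m)⁻¹ 0 0 =
      ∑ c ∈ Finset.univ.filter (fun c : Fin (r + 1) => (c : ℕ) + 1 < a), resolventP r R m 0 c := by
  rw [transfer_resolvent hR, Matrix.mul_apply, Finset.sum_filter]
  refine Finset.sum_congr rfl fun p _ => ?_
  have h0 := mulVec_ev (matF K r m) p 0
  rw [Fin.val_zero, zero_add, h, sum_ev_apply] at h0
  rw [const, Matrix.map_apply, ← h0]
  split_ifs <;> simp

theorem transfer_resolvent_of_isSegment (hR : IsSolution r R) {a b : ℕ}
    (hs : IsSegment r m 1 a b) (hmin : ∀ a' b', IsSegment r m 1 a' b' → a ≤ a') :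
    (1 - transfer r R m)⁻¹ 0 0 = ∑ c ∈ Finset.univ.filter
      (fun c : Fin (r + 1) => (c : ℕ) + 1 ≤ a + 1), resolventP r R m 0 c := by
  have hbr := hs.2.2.1
  have hab := hs.2.1
  -- The bound is exclusive. The column recursion stops at the first ascending vertex `a`, where it
  -- contributes both `ev a` and `ev (a + 1)`.
  rw [transfer_resolvent_of_first_column hR (a := a + 2)]
  · congr 1
    ext c
    simp only [Finset.mem_filter, Finset.mem_univ, true_and]
    omega
  · rw [matF_first_column (a := a) ?_ (by omega) hs.1, matF_mulVec_ev hs.1 (by omega),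
      if_pos (hs.isStep le_rfl hab), Finset.sum_Ico_succ_top (by omega),
      Finset.sum_Ico_succ_top hs.1, add_assoc]
    intro i h1 h2 hst
    obtain ⟨a', b', hs', h3, -⟩ := exists_isSegment (i := i) (j := i + 1) (by omega)
      fun k hk1 hk2 => by obtain rfl : k = i := by omega
                          exact hst
    have := hmin a' b' hs'
    omega

theorem transfer_resolvent_of_forall_not_isSegment (hR : IsSolution r R)
    (hs : ∀ a b, ¬ IsSegment r m 1 a b) :
    (1 - transfer r R m)⁻¹ 0 0 = ∑ c : Fin (r + 1), resolventP r R m 0 c := by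
  rw [transfer_resolvent_of_first_column hR (a := r + 2)]
  · congr 1
    ext c
    simp only [Finset.mem_filter, Finset.mem_univ, true_and, iff_true]
    omega
  · rw [matF_first_column (a := r + 1) ?_ le_rfl (by omega), matF_mulVec_ev_top,
      ← Finset.sum_Ico_succ_top (by omega)]
    intro i h1 h2 hst
    obtain ⟨a', b', hs', -⟩ := exists_isSegment (i := i) (j := i + 1) (by omega)
      fun k hk1 hk2 => by obtain rfl : k = i := by omega
                          exact hst
    exact hs a' b' hs'

end Resolvent

end QSystem

theorem mainTheorem6 {K : Type*} [Field K] (r : ℕ) (m : ℕ → ℤ) (R : ℕ → ℤ → K)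
    (hm : QSystem.IsMotzkinPath r m) (hR : QSystem.IsSolution r R) :
    -- the splitting of the compact transfer matrix
    (QSystem.transfer r R m =
      QSystem.strictLower (QSystem.transfer r R m) + QSystem.upperPart (QSystem.transfer r R m)) ∧
    IsUnit (QSystem.matF K r m).det ∧
    (QSystem.strictLower (QSystem.transfer r R m) = 1 - QSystem.const K (QSystem.matF K r m)⁻¹) ∧
    (QSystem.upperPart (QSystem.transfer r R m) =
      (PowerSeries.X : PowerSeries K) • QSystem.const K (QSystem.matD r R m * QSystem.matE r R m)) ∧
    -- the resolvent identity, both inverses being genuine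
    IsUnit (1 - QSystem.transfer r R m).det ∧
    IsUnit (1 - (PowerSeries.X : PowerSeries K) • QSystem.const K (QSystem.matP r R m)).det ∧
    ((1 - QSystem.transfer r R m)⁻¹ =
      QSystem.resolventP r R m * QSystem.const K (QSystem.matF K r m)) ∧
    -- the matrix `P_m` lies in a Coxeter double Bruhat cell
    QSystem.IsCoxeterElement r (QSystem.reflProd r (QSystem.sigmaSeq r m)) ∧
    QSystem.IsCoxeterElement r (QSystem.reflProd r (QSystem.tauSeq r m)) ∧
    (QSystem.matP r R m ∈ QSystem.doubleBruhatCell K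
      (QSystem.reflProd r (QSystem.sigmaSeq r m)) (QSystem.reflProd r (QSystem.tauSeq r m))) ∧
    -- the `(1,1)` entry of the resolvent generates `R_{1,n+m_1+1}`
    (∀ n : ℕ, R 1 (n + m 1 + 1) =
      R 1 (m 1 + 1) * PowerSeries.coeff n ((1 - QSystem.transfer r R m)⁻¹ 0 0)) ∧
    -- and it is a sum of entries of the first row of `(I - t P_m)⁻¹`:
    -- with `a` the starting point of the first ascending segment, if there is one
    (∀ a b : ℕ, QSystem.IsSegment r m 1 a b →
      (∀ a' b' : ℕ, QSystem.IsSegment r m 1 a' b' → a ≤ a') →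
      (1 - QSystem.transfer r R m)⁻¹ 0 0 =
        ∑ c ∈ Finset.univ.filter (fun c : Fin (r + 1) => (c : ℕ) + 1 ≤ a + 1), QSystem.resolventP r R m 0 c) ∧
    -- and the full row sum if there is no ascending segment
    ((∀ a b : ℕ, ¬ QSystem.IsSegment r m 1 a b) →
      (1 - QSystem.transfer r R m)⁻¹ 0 0 = ∑ c : Fin (r + 1), QSystem.resolventP r R m 0 c) := by
  open QSystem in
  exact ⟨transfer_eq_add, Matrix.isUnit_det_of_right_inverse matF_mul_invF,
    by rw [strictLower_transfer, matF_inv], upperPart_transfer_eq hR,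
    Matrix.isUnit_det_of_right_inverse (one_sub_transfer_mul hR), isUnit_det_one_sub _,
    transfer_resolvent hR, isCoxeterElement_reorder 1, isCoxeterElement_reorder (-1),
    matP_mem_doubleBruhatCell (fun i hi => yOdd_ne_zero hR (by omega))
      (fun i _ hi => yEven_ne_zero hR hi),
    fun n => by rw [coeff_transfer_resolvent hR]; exact matP_pow_mul_matF hm hR n,
    fun a b hs hmin => transfer_resolvent_of_isSegment hR hs hmin,
    transfer_resolvent_of_forall_not_isSegment hR⟩
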